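/- Let $d\ge 1$ and let $T(d,\mathbb R)_+=\{h\in GL(d,\mathbb R): h_{1,1}>0,\ h_{i,j}=0 \text{ for } i>j\}$. Let $H$ be any subgroup of $T(d,\mathbb R)_+$ and let $G=\mathbb R^d\rtimes H$, with product $(b_1,h_1)(b_2,h_2)=(b_1+h_1b_2,h_1h_2)$. The quasi-regular representation $\pi$ of $G$ on $L^2(\mathbb R^d)$ is $[\pi(b,h)f](y)=|\det h|^{-1/2}f(h^{-1}(y-b))$. For $b\in\mathbb R^d$ let $\sigma_b$ be the symmetric $d\times d$ matrix whose first row and first column are $(b_1,b_2/2,\dots,b_d/2)$ and whose other entries are $0$. Let $\rho(h)=\sqrt{h_{1,1}}\,h^{-T}$, and for $\sigma$ symmetric and $M\in GL(d,\mathbb R)$ let $g(\sigma,M)=\begin{pmatrix}M&0\\ \sigma M&M^{-T}\end{pmatrix}$. Let $\Theta_L=\{\xi\in\mathbb R^d:\xi_1\le 0\}$, let $\hat f(\xi)=(\mathcal Ff)(\xi)=\int f(x)e^{-2\pi i\langle x,\xi\rangle}\,dx$ (extended to $L^2$), and let $\mathcal H=\{f\in L^2(\mathbb R^d):\operatorname{supp}\hat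 f\subseteq\Theta_L\}$, so that $\mathcal F$ maps $\mathcal H$ unitarily onto $L^2(\Theta_L)\subseteq L^2(\mathbb R^d)$. For $z=(p,\omega)\in\mathbb R^{2d}$ let $[W(z)f](t)=e^{2\pi i\langle\omega,t\rangle-\pi i\langle p,\omega\rangle}f(t-p)$. The metaplectic group, as an extension of $Sp(d,\mathbb R)\subset GL(2d,\mathbb R)$ by the circle, is the group of pairs $(S,U)$, where $S\in Sp(d,\mathbb R)$ and $U$ is a unitary operator on $L^2(\mathbb R^d)$ with $UW(z)U^{-1}=W(Sz)$ for all $z$. The metaplectic representation $\mu$ is $(S,U)\mapsto U$; on $Sp(d,\mathbb R)$ it is thus determined up to a scalar of modulus one. Then the following hold. 1. The map $\phi(b,h)=g(\sigma_b,\rho(h))$ is an injective group homomorphism $\phi\colon G\to Sp(d,\mathbb R)$. 2. The map $\phi$ lifts to a homomorphism from $G$ into the metaplectic group such that $\mu\circ\phi$ (that is, $\mu$ composed with this lift) is the representation $$[\mu(\phi(b,h))f](\xi)=|\det\rho(h)|^{-1/2}\,e^{\pi i\langle\sigma_b\xi,\xi\rangle}\,f(\rho(h)^{-1}\xi).$$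 3. The subspace $\mathcal H$ is invariant under $\pi$, the subspace $L^2(\Theta_L)=\mathcal F\mathcal H$ is invariant under $\mu\circ\phi$, and the restriction $\pi|_{\mathcal H}$ is unitarily equivalent to the restriction $\mu\circ\phi|_{L^2(\Theta_L)}$ (that is, to $\mu\circ\phi$ on $\mathcal H$ when $\mu$ acts on the Fourier side). More precisely, the map $Q(\xi)=-\tfrac12\xi_1\xi$ sends $\Theta_L$ into itself and restricts to a bijection of the interior $\{\xi_1<0\}$, with inverse $Q^{-1}(\xi)=\sqrt2\,\xi/\sqrt{-\xi_1}$. The formula $$\Psi f(\xi)=|\det J_{Q^{-1}}(\xi)|^{1/2}f(Q^{-1}(\xi)),\qquad\text{for a.e. }\xi\in\Theta_L,$$ defines a unitary operator $\Psi$ of $L^2(\Theta_L)$, and the unitary operator $\Psi^{-1}\mathcal F\colon\mathcal H\to L^2(\Theta_L)$ intertwines $\pi|_{\mathcal H}$ with $\mu\circ\phi|_{L^2(\Theta_L)}$. Equivalently, on $L^2(\Theta_L)$, $$\Psi\,\mu(\phi(b,h))\,\Psi^{-1}=\mathcal F\pi(b,h)\mathcal F^{-1}\qquad\text{for all }(b,h)\in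 G.$$ -/

import Mathlib

open MeasureTheory Matrix Filter Set
open scoped FourierTransform ENNReal MatrixGroups

noncomputable section

namespace ShearletSymplectic

/-- Euclidean space `ℝ^d`. -/
abbrev E (d : ℕ) := EuclideanSpace ℝ (Fin d)

/-- The complex Hilbert space `L²(ℝ^d)` (Lebesgue measure). -/
abbrev L2 (d : ℕ) := Lp (α := E d) ℂ 2 (volume : Measure (E d))

/-- The linear map `x ↦ M x` of `ℝ^d` given by a matrix `M`. -/
abbrev act {d : ℕ} (M : Matrix (Fin d) (Fin d) ℝ) : E d →L[ℝ] E d :=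
  Matrix.toEuclideanCLM (n := Fin d) (𝕜 := ℝ) M

theorem act_mul {d : ℕ} (M N : Matrix (Fin d) (Fin d) ℝ) (x : E d) :
    act (M * N) x = act M (act N x) := by
  rw [act, map_mul]; rfl

theorem act_one {d : ℕ} (x : E d) : act (1 : Matrix (Fin d) (Fin d) ℝ) x = x := by
  rw [act, map_one]; rfl

theorem act_inv_act {d : ℕ} (h : GL (Fin d) ℝ) (x : E d) :
    act (h⁻¹).val (act h.val x) = x := by
  rw [← act_mul, ← Units.val_mul, inv_mul_cancel, Units.val_one, act_one]

theorem act_act_inv {d : ℕ} (h : GL (Fin d) ℝ) (x : E d) :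
    act h.val (act (h⁻¹).val x) = x := by
  rw [← act_mul, ← Units.val_mul, mul_inv_cancel, Units.val_one, act_one]

theorem det_act {d : ℕ} (M : Matrix (Fin d) (Fin d) ℝ) :
    LinearMap.det (act M : E d →ₗ[ℝ] E d) = M.det := by
  rw [Matrix.coe_toEuclideanCLM_eq_toEuclideanLin, Matrix.toEuclideanLin_eq_toLin_orthonormal,
    LinearMap.det_toLin]

/-! ### The groups -/

/-- `T(d,ℝ)₊`: invertible upper triangular matrices with positive `(1,1)` entry. -/
def Tplus (d : ℕ) [NeZero d] : Subgroup (GL (Fin d) ℝ) where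
  carrier := {h | 0 < h.val 0 0 ∧ ∀ i j, j < i → h.val i j = 0}
  one_mem' := by
    refine ⟨by simp, fun i j hij => ?_⟩
    simp [Matrix.one_apply_ne (ne_of_gt hij)]
  mul_mem' := by
    rintro a b ⟨ha0, ha⟩ ⟨hb0, hb⟩
    have hmul : (a * b).val = a.val * b.val := rfl
    refine ⟨?_, fun i j hij => ?_⟩
    · rw [hmul, Matrix.mul_apply, Finset.sum_eq_single 0]
      · exact mul_pos ha0 hb0
      · intro k _ hk
        rw [hb k 0 (Fin.pos_iff_ne_zero.2 hk), mul_zero]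
      · simp
    · rw [hmul]
      exact (Matrix.BlockTriangular.mul (M := a.val) (N := b.val) (b := id)
        (fun i j h => ha i j h) (fun i j h => hb i j h)) hij
  inv_mem' := by
    rintro a ⟨ha0, ha⟩
    have hinv : ∀ i j, j < i → (a⁻¹).val i j = 0 := by
      have : Invertible a.val := a.invertible
      have h1 := Matrix.blockTriangular_inv_of_blockTriangular (M := a.val) (b := id)
        (fun i j h => ha i j h)
      intro i j hij
      rw [Matrix.coe_units_inv]
      exact h1 hij
    refine ⟨?_, hinv⟩
    have h1 : (a.val * (a⁻¹).val) 0 0 = 1 := by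
      rw [← Units.val_mul, mul_inv_cancel]; simp
    rw [Matrix.mul_apply, Finset.sum_eq_single 0] at h1
    · by_contra hcon
      have := mul_nonpos_of_nonneg_of_nonpos ha0.le (not_lt.1 hcon)
      linarith
    · intro k _ hk
      rw [hinv k 0 (Fin.pos_iff_ne_zero.2 hk), mul_zero]
    · simp

/-- The action of `H` on the translation group `ℝ^d`, `h ↦ (b ↦ h b)`. -/
def dilationAction {d : ℕ} (H : Subgroup (GL (Fin d) ℝ)) : H →* MulAut (Multiplicative (E d)) where
  toFun h :=
    { toFun := fun b => Multiplicative.ofAdd (act h.val.val b.toAdd)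
      invFun := fun b => Multiplicative.ofAdd (act (h.val⁻¹).val b.toAdd)
      left_inv := fun b => congrArg Multiplicative.ofAdd (act_inv_act h.val b.toAdd)
      right_inv := fun b => congrArg Multiplicative.ofAdd (act_act_inv h.val b.toAdd)
      map_mul' := fun b c => by simp }
  map_one' := by ext1 b; simp
  map_mul' h k := by ext1 b; simp

/-- The semidirect product `G = ℝ^d ⋊ H`, with `(b₁,h₁)(b₂,h₂) = (b₁ + h₁ b₂, h₁ h₂)`. -/
abbrev AffGroup {d : ℕ} (H : Subgroup (GL (Fin d) ℝ)) := Multiplicative (E d) ⋊[dilationAction H] H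

/-- The translation part `b ∈ ℝ^d` of `(b,h) ∈ ℝ^d ⋊ H`. -/
def AffGroup.b {d : ℕ} {H : Subgroup (GL (Fin d) ℝ)} (x : AffGroup H) : E d := x.left.toAdd

/-- The dilation part `h` of `(b,h) ∈ ℝ^d ⋊ H`. -/
def AffGroup.h {d : ℕ} {H : Subgroup (GL (Fin d) ℝ)} (x : AffGroup H) : GL (Fin d) ℝ := x.right

/-! ### The matrices `σ_b`, `ρ(h)` and `g(σ,M)` -/

/-- The symmetric matrix `σ_b`: first row and first column `(b₁, b₂/2, …, b_d/2)`, all other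
entries zero. -/
def sigma {d : ℕ} [NeZero d] (b : E d) : Matrix (Fin d) (Fin d) ℝ :=
  Matrix.of fun i j =>
    if i = 0 then (if j = 0 then b 0 else b j / 2) else (if j = 0 then b i / 2 else 0)

/-- `ρ(h) = √h₁₁ h^{-T}`. -/
def rho {d : ℕ} [NeZero d] (h : GL (Fin d) ℝ) : Matrix (Fin d) (Fin d) ℝ :=
  Real.sqrt (h.val 0 0) • ((h⁻¹).val)ᵀ

/-- The block matrix `g(σ,M) = (M, 0; σ M, M^{-T})`. -/
def gMat {d : ℕ} (σ M : Matrix (Fin d) (Fin d) ℝ) : Matrix (Fin d ⊕ Fin d) (Fin d ⊕ Fin d) ℝ :=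
  Matrix.fromBlocks M 0 (σ * M) (M⁻¹)ᵀ

/-! ### The quasi-regular representation -/

/-- `y ↦ |det h|^{-1/2} f(h⁻¹ (y - b))`. -/
def affFun {d : ℕ} (b : E d) (h : GL (Fin d) ℝ) (f : E d → ℂ) : E d → ℂ := fun y =>
  ((|h.val.det| ^ (-(1 / 2) : ℝ) : ℝ) : ℂ) * f (act (h⁻¹).val (y - b))

theorem map_affine {d : ℕ} (b : E d) (h : GL (Fin d) ℝ) :
    Measure.map (fun y => act (h⁻¹).val (y - b)) (volume : Measure (E d)) =
      ENNReal.ofReal |h.val.det| • (volume : Measure (E d)) := by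
  have hdet : (h⁻¹).val.det ≠ 0 := by
    have := (Matrix.isUnit_iff_isUnit_det _).1 (h⁻¹).isUnit
    exact this.ne_zero
  have h1 : (fun y => act (h⁻¹).val (y - b)) = (act (h⁻¹).val) ∘ fun y : E d => y - b := rfl
  have hm : Measurable (fun y : E d => y - b) := measurable_id.sub_const b
  rw [h1, ← Measure.map_map (act (h⁻¹).val).continuous.measurable hm,
    (measurePreserving_sub_right (volume : Measure (E d)) b).map_eq]
  have h2 := Measure.map_linearMap_addHaar_eq_smul_addHaar (volume : Measure (E d))
    (f := (act (h⁻¹).val : E d →ₗ[ℝ] E d)) (by rw [det_act]; exact hdet)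
  rw [det_act] at h2
  have h3 : ((h⁻¹).val.det)⁻¹ = h.val.det := by
    rw [Matrix.coe_units_inv, Matrix.det_nonsing_inv, Ring.inverse_eq_inv', inv_inv]
  rw [h3] at h2
  exact h2

theorem measurable_affine {d : ℕ} (b : E d) (h : GL (Fin d) ℝ) :
    Measurable (fun y => act (h⁻¹).val (y - b)) :=
  (act (h⁻¹).val).continuous.measurable.comp (measurable_id.sub_const b)

theorem qmp_affine {d : ℕ} (b : E d) (h : GL (Fin d) ℝ) :
    Measure.QuasiMeasurePreserving (fun y => act (h⁻¹).val (y - b))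
      (volume : Measure (E d)) volume := by
  refine ⟨measurable_affine b h, ?_⟩
  rw [map_affine]
  exact Measure.smul_absolutelyContinuous

theorem affFun_congr {d : ℕ} (b : E d) (h : GL (Fin d) ℝ) {f g : E d → ℂ}
    (hfg : f =ᵐ[volume] g) : affFun b h f =ᵐ[volume] affFun b h g := by
  filter_upwards [(qmp_affine b h).ae_eq_comp hfg] with y hy
  simp only [Function.comp_apply] at hy
  simp only [affFun, hy]

theorem eLpNorm_affFun {d : ℕ} (b : E d) (h : GL (Fin d) ℝ) {f : E d → ℂ}
    (hf : AEStronglyMeasurable f volume) :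
    eLpNorm (affFun b h f) 2 volume = eLpNorm f 2 volume := by
  have hpos : 0 < |h.val.det| :=
    abs_pos.2 ((Matrix.isUnit_iff_isUnit_det _).1 h.isUnit).ne_zero
  have hne : ENNReal.ofReal |h.val.det| ≠ 0 := by simpa using hpos
  have h1 : affFun b h f = ((|h.val.det| ^ (-(1 / 2) : ℝ) : ℝ) : ℂ) •
      (f ∘ fun y => act (h⁻¹).val (y - b)) := rfl
  rw [h1, eLpNorm_const_smul, ← eLpNorm_map_measure (g := f)
    (by rw [map_affine]; exact hf.smul_measure _) (measurable_affine b h).aemeasurable,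
    map_affine, eLpNorm_smul_measure_of_ne_zero hne, smul_eq_mul, ← mul_assoc]
  have h2 : ‖((|h.val.det| ^ (-(1 / 2) : ℝ) : ℝ) : ℂ)‖ₑ *
      ENNReal.ofReal |h.val.det| ^ (1 / (2 : ℝ≥0∞)).toReal = 1 := by
    rw [← ofReal_norm, Complex.norm_real, Real.norm_eq_abs,
      abs_of_nonneg (Real.rpow_nonneg hpos.le _), ENNReal.ofReal_rpow_of_pos hpos,
      ← ENNReal.ofReal_mul (Real.rpow_nonneg hpos.le _), ← Real.rpow_add hpos]
    norm_num
  rw [h2, one_mul]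

theorem memLp_affFun {d : ℕ} (b : E d) (h : GL (Fin d) ℝ) {f : E d → ℂ}
    (hf : MemLp f 2 volume) : MemLp (affFun b h f) 2 volume := by
  refine ⟨?_, ?_⟩
  · exact (hf.1.comp_quasiMeasurePreserving (qmp_affine b h)).const_mul _
  · rw [eLpNorm_affFun b h hf.1]; exact hf.2

theorem affFun_affFun {d : ℕ} (b c : E d) (h k : GL (Fin d) ℝ) (f : E d → ℂ) :
    affFun b h (affFun c k f) = affFun (b + act h.val c) (h * k) f := by
  funext y
  have hdet : (h * k).val.det = h.val.det * k.val.det := by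
    rw [Units.val_mul, Matrix.det_mul]
  have harg : act ((h * k)⁻¹).val (y - (b + act h.val c)) =
      act (k⁻¹).val (act (h⁻¹).val (y - b) - c) := by
    rw [_root_.mul_inv_rev, Units.val_mul, act_mul, ← sub_sub, map_sub (act (h⁻¹).val) (y - b),
      act_inv_act]
  simp only [affFun]
  rw [harg, hdet, abs_mul, Real.mul_rpow (abs_nonneg _) (abs_nonneg _)]
  push_cast
  ring

theorem affFun_one {d : ℕ} (f : E d → ℂ) : affFun 0 1 f = f := by
  funext y
  simp only [affFun, inv_one, Units.val_one, act_one, sub_zero, Matrix.det_one, abs_one,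
    Real.one_rpow, Complex.ofReal_one, one_mul]

/-- The isometry `f ↦ |det h|^{-1/2} f(h⁻¹ (· - b))` of `L²(ℝ^d)`. -/
def affOp {d : ℕ} (b : E d) (h : GL (Fin d) ℝ) : L2 d →ₗᵢ[ℂ] L2 d where
  toFun f := (memLp_affFun b h (Lp.memLp f)).toLp _
  map_add' f g := by
    rw [← MemLp.toLp_add, MemLp.toLp_eq_toLp_iff]
    refine (affFun_congr b h (Lp.coeFn_add f g)).trans (Eventually.of_forall fun y => ?_)
    simp only [affFun, Pi.add_apply, mul_add]
  map_smul' c f := by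
    rw [RingHom.id_apply, ← MemLp.toLp_const_smul, MemLp.toLp_eq_toLp_iff]
    refine (affFun_congr b h (Lp.coeFn_smul c f)).trans (Eventually.of_forall fun y => ?_)
    simp only [affFun, Pi.smul_apply, smul_eq_mul]
    ring
  norm_map' f := by
    change ‖(memLp_affFun b h (Lp.memLp f)).toLp _‖ = ‖f‖
    rw [Lp.norm_toLp, eLpNorm_affFun b h (Lp.aestronglyMeasurable f), Lp.norm_def]

theorem coeFn_affOp {d : ℕ} (b : E d) (h : GL (Fin d) ℝ) (f : L2 d) :
    affOp b h f =ᵐ[volume] affFun b h f :=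
  MemLp.coeFn_toLp (memLp_affFun b h (Lp.memLp f))

theorem affOp_affOp {d : ℕ} (b c : E d) (h k : GL (Fin d) ℝ) (f : L2 d) :
    affOp b h (affOp c k f) = affOp (b + act h.val c) (h * k) f := by
  apply Lp.ext
  refine (coeFn_affOp _ _ _).trans ((affFun_congr _ _ (coeFn_affOp _ _ _)).trans ?_)
  rw [affFun_affFun]
  exact (coeFn_affOp _ _ _).symm

theorem affOp_one {d : ℕ} (f : L2 d) : affOp 0 1 f = f := by
  apply Lp.ext
  refine (coeFn_affOp _ _ _).trans ?_
  rw [affFun_one]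

theorem affOp_mul {d : ℕ} {H : Subgroup (GL (Fin d) ℝ)} (x y : AffGroup H) (f : L2 d) :
    affOp (x * y).b (x * y).h f = affOp x.b x.h (affOp y.b y.h f) := by
  rw [affOp_affOp]; rfl

/-- The quasi-regular representation of `G = ℝ^d ⋊ H` on `L²(ℝ^d)`,
`[π(b,h) f](y) = |det h|^{-1/2} f(h⁻¹ (y - b))`. -/
def quasiRegular {d : ℕ} (H : Subgroup (GL (Fin d) ℝ)) : AffGroup H →* (L2 d ≃ₗᵢ[ℂ] L2 d) where
  toFun x :=
    { toLinearEquiv := LinearEquiv.ofLinearMap (affOp x.b x.h).toLinearMap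
        (affOp (x⁻¹).b (x⁻¹).h).toLinearMap
        (by
          ext1 f
          change affOp x.b x.h (affOp (x⁻¹).b (x⁻¹).h f) = f
          rw [← affOp_mul, mul_inv_cancel]; exact affOp_one f)
        (by
          ext1 f
          change affOp (x⁻¹).b (x⁻¹).h (affOp x.b x.h f) = f
          rw [← affOp_mul, inv_mul_cancel]; exact affOp_one f)
      norm_map' := (affOp x.b x.h).norm_map }
  map_one' := by ext1 f; exact affOp_one f
  map_mul' x y := by ext1 f; exact affOp_mul x y f

/-! ### The metaplectic representation -/

/-- Position component `p` of a phase space point `z = (p,ω) ∈ ℝ^d × ℝ^d`. -/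
def pos {d : ℕ} (z : Fin d ⊕ Fin d → ℝ) : E d := WithLp.toLp 2 fun i => z (Sum.inl i)

/-- Frequency component `ω` of a phase space point `z = (p,ω) ∈ ℝ^d × ℝ^d`. -/
def freq {d : ℕ} (z : Fin d ⊕ Fin d → ℝ) : E d := WithLp.toLp 2 fun i => z (Sum.inr i)

/-- `t ↦ e^{2πi ⟨ω,t⟩ - πi ⟨p,ω⟩} f(t - p)` for `z = (p,ω)`. -/
def weylFun {d : ℕ} (z : Fin d ⊕ Fin d → ℝ) (f : E d → ℂ) : E d → ℂ := fun t =>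
  Complex.exp (((2 * Real.pi * inner ℝ (freq z) t - Real.pi * inner ℝ (pos z) (freq z) : ℝ) : ℂ) *
    Complex.I) * f (t - pos z)

theorem memLp_weylFun {d : ℕ} (z : Fin d ⊕ Fin d → ℝ) {f : E d → ℂ} (hf : MemLp f 2 volume) :
    MemLp (weylFun z f) 2 volume := by
  have h1 : MemLp (fun t => f (t - pos z)) 2 volume :=
    hf.comp_measurePreserving (measurePreserving_sub_right (volume : Measure (E d)) (pos z))
  refine h1.of_le ?_ (Eventually.of_forall fun t => ?_)
  · refine AEStronglyMeasurable.mul (Continuous.aestronglyMeasurable ?_) h1.1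
    fun_prop
  · rw [weylFun, norm_mul, Complex.norm_exp_ofReal_mul_I, one_mul]

/-- The Weyl (Schrödinger) operator `W(z)` on `L²(ℝ^d)` of a phase space point `z = (p,ω)`:
`[W(z) f](t) = e^{2πi ⟨ω,t⟩ - πi ⟨p,ω⟩} f(t - p)`. -/
def weyl {d : ℕ} (z : Fin d ⊕ Fin d → ℝ) (f : L2 d) : L2 d :=
  (memLp_weylFun z (Lp.memLp f)).toLp _

/-- The metaplectic group, in its form as extension of `Sp(d,ℝ)` by the circle: the pairs `(S,U)`
of a symplectic matrix `S` and a unitary operator `U` on `L²(ℝ^d)` with `U W(z) U⁻¹ = W(S z)` for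
all phase space points `z`. By the Stone–von Neumann theorem and Schur's lemma, `U` exists for
every `S` and is unique up to a scalar of modulus one. -/
def metaplecticGroup (d : ℕ) :
    Subgroup (Matrix.symplecticGroup (Fin d) ℝ × (L2 d ≃ₗᵢ[ℂ] L2 d)) where
  carrier := {p | ∀ (z : Fin d ⊕ Fin d → ℝ) (f : L2 d),
    p.2 (weyl z f) = weyl (p.1.val *ᵥ z) (p.2 f)}
  one_mem' := by intro z f; simp
  mul_mem' := by
    intro p q hp hq z f
    change p.2 (q.2 (weyl z f)) = weyl ((p.1 * q.1).val *ᵥ z) (p.2 (q.2 f))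
    rw [hq, hp, Submonoid.coe_mul, Matrix.mulVec_mulVec]
  inv_mem' := by
    intro p hp z f
    change p.2.symm (weyl z f) = weyl ((p.1⁻¹).val *ᵥ z) (p.2.symm f)
    rw [LinearIsometryEquiv.symm_apply_eq, hp, Matrix.mulVec_mulVec, ← Submonoid.coe_mul,
      mul_inv_cancel, Submonoid.coe_one, Matrix.one_mulVec, LinearIsometryEquiv.apply_symm_apply]

/-- The projection of the metaplectic group onto `Sp(d,ℝ)`. -/
def metaplecticProj (d : ℕ) : metaplecticGroup d →* Matrix.symplecticGroup (Fin d) ℝ :=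
  (MonoidHom.fst _ _).comp (metaplecticGroup d).subtype

/-- The metaplectic representation `μ` on `L²(ℝ^d)`. -/
def metaplecticRep (d : ℕ) : metaplecticGroup d →* (L2 d ≃ₗᵢ[ℂ] L2 d) :=
  (MonoidHom.snd _ _).comp (metaplecticGroup d).subtype

/-! ### The subspaces, and the change of variables -/

/-- `Θ_L = {ξ : ξ₁ ≤ 0}`. -/
def ThetaL (d : ℕ) [NeZero d] : Set (E d) := {ξ | ξ 0 ≤ 0}

/-- `L²(Θ_L)`, as the subspace of the functions in `L²(ℝ^d)` that vanish a.e. outside `Θ_L`. -/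
def L2Theta (d : ℕ) [NeZero d] : Submodule ℂ (L2 d) where
  carrier := {f | ∀ᵐ ξ : E d, ξ ∉ ThetaL d → f ξ = 0}
  zero_mem' := by
    filter_upwards [Lp.coeFn_zero ℂ 2 (volume : Measure (E d))] with ξ h1 _
    rw [h1]; rfl
  add_mem' := by
    intro f g hf hg
    filter_upwards [hf, hg, Lp.coeFn_add f g] with ξ h1 h2 h3 h4
    rw [h3, Pi.add_apply, h1 h4, h2 h4, add_zero]
  smul_mem' := by
    intro c f hf
    filter_upwards [hf, Lp.coeFn_smul c f] with ξ h1 h3 h4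
    rw [h3, Pi.smul_apply, h1 h4, smul_zero]

/-- The Fourier transform of `L²(ℝ^d)`, extending `f̂(ξ) = ∫ f(x) e^{-2πi ⟨x,ξ⟩} dx`. -/
abbrev fourierL2 (d : ℕ) : L2 d ≃ₗᵢ[ℂ] L2 d := Lp.fourierTransformₗᵢ (E d) ℂ

/-- The unitary operator `U⁻¹(K) → K` to which a unitary operator `U` restricts. -/
def comapIsometry {V : Type*} [NormedAddCommGroup V] [InnerProductSpace ℂ V]
    (U : V ≃ₗᵢ[ℂ] V) (K : Submodule ℂ V) :
    K.comap U.toLinearEquiv.toLinearMap ≃ₗᵢ[ℂ] K where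
  toFun f := ⟨U f.val, f.property⟩
  invFun g := ⟨U.symm g.val, by
    change U (U.symm g.val) ∈ K
    rw [LinearIsometryEquiv.apply_symm_apply]; exact g.property⟩
  map_add' f g := by ext1; exact map_add U f.val g.val
  map_smul' c f := by ext1; exact map_smul U c f.val
  left_inv f := by ext1; exact U.symm_apply_apply f.val
  right_inv g := by ext1; exact U.apply_symm_apply g.val
  norm_map' f := U.norm_map f.val

/-- `𝓗 = {f ∈ L²(ℝ^d) : supp f̂ ⊆ Θ_L}` (`Θ_L` is closed, so the essential support of `f̂` lies in
it iff `f̂ = 0` a.e. outside it). -/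
def calH (d : ℕ) [NeZero d] : Submodule ℂ (L2 d) :=
  (L2Theta d).comap (fourierL2 d).toLinearEquiv.toLinearMap

/-- The unitary operator `𝓗 → L²(Θ_L)` to which the Fourier transform restricts. -/
def fourierH (d : ℕ) [NeZero d] : calH d ≃ₗᵢ[ℂ] L2Theta d :=
  comapIsometry (fourierL2 d) (L2Theta d)

/-- `Q(ξ) = -½ ξ₁ ξ`. -/
def Qmap {d : ℕ} [NeZero d] (ξ : E d) : E d := (-(1 / 2) * ξ 0) • ξ

/-- The inverse `Q⁻¹(ξ) = √2 ξ / √(-ξ₁)` of `Q` on `{ξ₁ < 0}`. -/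
def Qinv {d : ℕ} [NeZero d] (ξ : E d) : E d := (Real.sqrt 2 / Real.sqrt (-ξ 0)) • ξ

/-! ### Restriction and unitary equivalence of representations -/

/-- The subrepresentation of a unitary representation on an invariant subspace. -/
def restrictRep {G V : Type*} [Group G] [NormedAddCommGroup V] [InnerProductSpace ℂ V]
    (τ : G →* (V ≃ₗᵢ[ℂ] V)) (K : Submodule ℂ V) (hK : ∀ x, ∀ f ∈ K, τ x f ∈ K) :
    G →* (K ≃ₗᵢ[ℂ] K) where
  toFun x :=
    { toFun := fun f => ⟨τ x f.val, hK x f.val f.property⟩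
      invFun := fun f => ⟨τ x⁻¹ f.val, hK x⁻¹ f.val f.property⟩
      map_add' := fun f g => by ext1; exact map_add (τ x) f.val g.val
      map_smul' := fun c f => by ext1; exact map_smul (τ x) c f.val
      left_inv := fun f => by
        ext1
        change (τ x⁻¹ * τ x) f.val = f.val
        rw [← map_mul, inv_mul_cancel, map_one]; rfl
      right_inv := fun f => by
        ext1
        change (τ x * τ x⁻¹) f.val = f.val
        rw [← map_mul, mul_inv_cancel, map_one]; rfl
      norm_map' := fun f => (τ x).norm_map f.val }
  map_one' := by
    ext1 f; ext1
    change τ 1 f.val = f.val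
    rw [map_one]; rfl
  map_mul' x y := by
    ext1 f; ext1
    change τ (x * y) f.val = τ x (τ y f.val)
    rw [map_mul]; rfl

/-- The unitary operator `T` intertwines the unitary representations `τ₁` and `τ₂`. -/
def Intertwines {G V W : Type*} [Group G] [NormedAddCommGroup V] [InnerProductSpace ℂ V]
    [NormedAddCommGroup W] [InnerProductSpace ℂ W] (T : V ≃ₗᵢ[ℂ] W)
    (τ₁ : G →* (V ≃ₗᵢ[ℂ] V)) (τ₂ : G →* (W ≃ₗᵢ[ℂ] W)) : Prop :=
  ∀ x v, T (τ₁ x v) = τ₂ x (T v)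

end ShearletSymplectic

end

open ShearletSymplectic

/-! Everything rests on how an upper triangular `h` acts on the first coordinate (index `0` below):
h e₁ = h₁₁ e₁, and dually (hᵀξ)₁ = h₁₁ ξ₁.

Since σ_b is the symmetrisation of b e₁ᵀ, the first identity gives h σ_b hᵀ = h₁₁ σ_{hb}
(`mul_sigma_mul_transpose`). The factor √h₁₁ in ρ is there to absorb h₁₁: ρ(h)⁻ᵀ σ_b ρ(h)⁻¹ =
σ_{hb}. Together with g(σ,M) g(τ,N) = g(σ + M⁻ᵀτM⁻¹, MN) this makes φ a homomorphism. The same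
identity makes the quadratic phases a cocycle, so the explicit operators e^{πi⟨σξ,ξ⟩} |det M|^{-1/2}
f(M⁻¹ξ), which satisfy the Weyl covariance relation for g(σ,M) (`metaFun_weylFun`), compose without
any scalar correction and give the lift.

On the Fourier side π(b,h) becomes an operator of the same shape, with the linear phase -2π⟨b,ξ⟩ and
the matrix h⁻ᵀ (`fourierL2_affOp`). The two families are conjugate under Q. Indeed ⟨σ_b ξ,ξ⟩ =
ξ₁⟨b,ξ⟩ = -2⟨b,Q(ξ)⟩ matches the phases, and Q⁻¹(hᵀξ) = ρ(h)⁻¹Q⁻¹(ξ) for ξ₁ < 0 matches the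
arguments. Differentiating the second relation matches the Jacobian factors, so the determinant of
DQ⁻¹ is never computed. Unitarity of Ψ is the change of variables formula on the open half-space,
which differs from Θ_L by a null set. -/

open ShearletSymplectic

noncomputable section

namespace ShearletSymplectic

/-! ### The matrices σ_b, ρ(h), g(σ,M) and the embedding φ -/

section Algebra

variable {d : ℕ}

theorem act_apply (M : Matrix (Fin d) (Fin d) ℝ) (x : E d) (i : Fin d) :
    act M x i = ∑ j, M i j * x j := rfl

theorem act_smul (c : ℝ) (M : Matrix (Fin d) (Fin d) ℝ) (x : E d) :
    act (c • M) x = c • act M x := by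
  rw [act, map_smul]; rfl

theorem inner_act_left (M : Matrix (Fin d) (Fin d) ℝ) (x y : E d) :
    inner ℝ (act M x) y = inner ℝ x (act Mᵀ y) := by
  simp only [PiLp.inner_apply, act_apply, RCLike.inner_apply, conj_trivial, Finset.mul_sum,
    Finset.sum_mul, Matrix.transpose_apply]
  rw [Finset.sum_comm]
  exact Finset.sum_congr rfl fun i _ => Finset.sum_congr rfl fun j _ => by ring

/-- The contragredient `h^{-T}` of an invertible matrix. -/
def contragredient (h : GL (Fin d) ℝ) : GL (Fin d) ℝ where
  val := (h⁻¹).valᵀ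
  inv := h.valᵀ
  val_inv := by rw [← Matrix.transpose_mul, ← Units.val_mul, mul_inv_cancel]; simp
  inv_val := by rw [← Matrix.transpose_mul, ← Units.val_mul, inv_mul_cancel]; simp

theorem contragredient_val (h : GL (Fin d) ℝ) : (contragredient h).val = (h⁻¹).valᵀ := rfl

theorem contragredient_inv_val (h : GL (Fin d) ℝ) : (contragredient h)⁻¹.val = h.valᵀ := rfl

theorem det_val_ne_zero (h : GL (Fin d) ℝ) : h.val.det ≠ 0 :=
  ((Matrix.isUnit_iff_isUnit_det _).1 h.isUnit).ne_zero

theorem det_inv_val (h : GL (Fin d) ℝ) : (h⁻¹).val.det = h.val.det⁻¹ := by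
  rw [Matrix.coe_units_inv, Matrix.det_nonsing_inv, Ring.inverse_eq_inv']

/-- g(σ,M) is the lower unipotent matrix of σ times diag(M, M⁻ᵀ). Conjugation by the diagonal factor
takes τ to M⁻ᵀτM⁻¹, and unipotent factors add. -/
theorem gMat_mul (σ τ : Matrix (Fin d) (Fin d) ℝ) (M N : GL (Fin d) ℝ) :
    gMat σ M.val * gMat τ N.val =
      gMat (σ + (contragredient M).val * τ * (M⁻¹).val) (M * N).val := by
  have h1 : (M⁻¹).val * M.val = 1 := by rw [← Units.val_mul, inv_mul_cancel]; rfl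
  simp only [gMat, Matrix.fromBlocks_multiply, contragredient_val, Units.val_mul,
    Matrix.mul_inv_rev, Matrix.transpose_mul]
  congr 1
  · simp
  · simp
  · rw [Matrix.add_mul]
    congr 1
    · simp only [Matrix.mul_assoc]
    · simp only [Matrix.mul_assoc]
      rw [← Matrix.mul_assoc (M⁻¹).val M.val N.val, h1, Matrix.one_mul,
        Matrix.coe_units_inv]
  · simp

/-- Symmetry of σ enters only through the lower right block of g J gᵀ, which is σᵀ - σ. -/
theorem gMat_mem_symplecticGroup {σ : Matrix (Fin d) (Fin d) ℝ} (hσ : σᵀ = σ)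
    (M : GL (Fin d) ℝ) : gMat σ M.val ∈ Matrix.symplecticGroup (Fin d) ℝ := by
  have h1 : M.val * (M⁻¹).val = 1 := by rw [← Units.val_mul, mul_inv_cancel]; rfl
  have h2 : (M⁻¹).valᵀ * M.valᵀ = 1 := by rw [← Matrix.transpose_mul, h1, Matrix.transpose_one]
  rw [SymplecticGroup.mem_iff, gMat, Matrix.J, ← Matrix.coe_units_inv,
    Matrix.fromBlocks_transpose, Matrix.fromBlocks_multiply, Matrix.fromBlocks_multiply]
  simp only [Matrix.mul_zero, Matrix.mul_one, Matrix.mul_neg, zero_add, Matrix.zero_mul,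
    Matrix.transpose_zero, Matrix.transpose_mul, hσ, Matrix.transpose_transpose, add_zero, h1,
    Matrix.neg_mul, Matrix.mul_assoc]
  congr 1
  rw [← Matrix.mul_assoc _ _ σ, h2, Matrix.one_mul, add_neg_cancel]

theorem gMat_injective {σ τ : Matrix (Fin d) (Fin d) ℝ} {M N : GL (Fin d) ℝ}
    (h : gMat σ M.val = gMat τ N.val) : σ = τ ∧ M = N := by
  obtain ⟨h1, -, h3, -⟩ := Matrix.fromBlocks_inj.1 h
  have hMN : M = N := Units.ext h1
  refine ⟨?_, hMN⟩
  rw [h1] at h3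
  exact N.isUnit.mul_right_cancel h3

variable [NeZero d]

/-- The symmetrised rank-one form, from which symmetry, additivity, the quadratic form and the
congruence by h are read off. -/
theorem sigma_eq (b : E d) :
    sigma b = (1 / 2 : ℝ) • (Matrix.vecMulVec b (Pi.single 0 1) +
      Matrix.vecMulVec (Pi.single 0 1) b) := by
  ext i j
  simp only [sigma, Matrix.of_apply, Matrix.smul_apply, Matrix.add_apply, Matrix.vecMulVec_apply,
    smul_eq_mul, Pi.single_apply]
  split_ifs with hi hj hj
  · subst hi hj; ring
  · ring
  · ring
  · ring

theorem sigma_transpose (b : E d) : (sigma b)ᵀ = sigma b := by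
  rw [sigma_eq, Matrix.transpose_smul, Matrix.transpose_add, Matrix.transpose_vecMulVec,
    Matrix.transpose_vecMulVec, add_comm]

theorem sigma_add (b c : E d) : sigma (b + c) = sigma b + sigma c := by
  simp only [sigma_eq, WithLp.ofLp_add, Matrix.add_vecMulVec, Matrix.vecMulVec_add]
  module

theorem sigma_injective : Function.Injective (sigma (d := d)) := by
  intro b c h
  ext i
  have h1 := congrFun (congrFun h 0) i
  simp only [sigma, Matrix.of_apply, if_true] at h1
  split_ifs at h1 with hi
  · rw [hi]; exact h1
  · linarith

/-- The quadratic form of σ_b splits into two linear factors, one of them ξ₁. It therefore equals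
-2⟨b,Q(ξ)⟩, which is where Q comes from. -/
theorem inner_act_sigma (b x : E d) :
    inner ℝ (act (sigma b) x) x = x 0 * inner ℝ b x := by
  have h1 : act (sigma b) x =
      (1 / 2 : ℝ) • (x 0 • b + (inner ℝ b x : ℝ) • EuclideanSpace.single 0 1) := by
    ext i
    simp [act_apply, sigma_eq, Matrix.vecMulVec_apply, Pi.single_apply, PiLp.inner_apply,
      Finset.mul_sum]
    split_ifs
    · simp only [mul_comm]
    · simp [mul_comm]
  rw [h1, inner_smul_left, inner_add_left, inner_smul_left, inner_smul_left,
    EuclideanSpace.inner_single_left]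
  simp
  ring

theorem Tplus_col_zero {h : GL (Fin d) ℝ} (hh : h ∈ Tplus d) (i : Fin d) (hi : i ≠ 0) :
    h.val i 0 = 0 :=
  hh.2 i 0 (Fin.pos_iff_ne_zero.2 hi)

theorem Tplus_mul_apply_zero {h k : GL (Fin d) ℝ} (hk : k ∈ Tplus d) :
    (h * k).val 0 0 = h.val 0 0 * k.val 0 0 := by
  rw [Units.val_mul, Matrix.mul_apply, Finset.sum_eq_single 0]
  · intro i _ hi
    rw [Tplus_col_zero hk i hi, mul_zero]
  · simp

theorem act_transpose_apply_zero {h : GL (Fin d) ℝ} (hh : h ∈ Tplus d) (x : E d) :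
    act h.valᵀ x 0 = h.val 0 0 * x 0 := by
  rw [act_apply, Finset.sum_eq_single 0]
  · rfl
  · intro i _ hi
    rw [Matrix.transpose_apply, Tplus_col_zero hh i hi, zero_mul]
  · simp

/-- Because e₁ is an eigenvector of h for h₁₁, congruence by h takes b e₁ᵀ to h₁₁ (hb) e₁ᵀ, and
likewise for the transposed term. -/
theorem mul_sigma_mul_transpose {h : GL (Fin d) ℝ} (hh : h ∈ Tplus d) (b : E d) :
    h.val * sigma b * h.valᵀ = h.val 0 0 • sigma (act h.val b) := by
  have h1 : h.val *ᵥ (Pi.single 0 1) = h.val 0 0 • Pi.single 0 1 := by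
    ext i
    rw [Matrix.mulVec_single_one, Matrix.col_apply, Pi.smul_apply, Pi.single_apply]
    split_ifs with hi
    · simp [hi]
    · simp [Tplus_col_zero hh i hi]
  have h2 : h.val *ᵥ b.ofLp = (act h.val b).ofLp := rfl
  rw [sigma_eq, sigma_eq, Matrix.mul_smul, Matrix.smul_mul, Matrix.mul_add, Matrix.add_mul,
    Matrix.mul_vecMulVec, Matrix.mul_vecMulVec, Matrix.vecMulVec_mul, Matrix.vecMulVec_mul,
    Matrix.vecMul_transpose, Matrix.vecMul_transpose, h1, h2, Matrix.vecMulVec_smul,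
    Matrix.smul_vecMulVec]
  module

/-- `ρ(h)` as an invertible matrix. -/
def rhoUnit {h : GL (Fin d) ℝ} (hh : h ∈ Tplus d) : GL (Fin d) ℝ where
  val := rho h
  inv := (Real.sqrt (h.val 0 0))⁻¹ • h.valᵀ
  val_inv := by
    have h1 : Real.sqrt (h.val 0 0) ≠ 0 := (Real.sqrt_pos.2 hh.1).ne'
    rw [rho, Matrix.smul_mul, Matrix.mul_smul, smul_smul, mul_inv_cancel₀ h1, one_smul]
    exact (contragredient h).val_inv
  inv_val := by
    have h1 : Real.sqrt (h.val 0 0) ≠ 0 := (Real.sqrt_pos.2 hh.1).ne'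
    rw [rho, Matrix.smul_mul, Matrix.mul_smul, smul_smul, inv_mul_cancel₀ h1, one_smul]
    exact (contragredient h).inv_val

theorem rhoUnit_val {h : GL (Fin d) ℝ} (hh : h ∈ Tplus d) : (rhoUnit hh).val = rho h := rfl

theorem rhoUnit_inv_val {h : GL (Fin d) ℝ} (hh : h ∈ Tplus d) :
    (rhoUnit hh)⁻¹.val = (Real.sqrt (h.val 0 0))⁻¹ • h.valᵀ := rfl

theorem rhoUnit_mul {h k : GL (Fin d) ℝ} (hh : h ∈ Tplus d) (hk : k ∈ Tplus d) :
    rhoUnit hh * rhoUnit hk = rhoUnit ((Tplus d).mul_mem hh hk) := by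
  ext1
  rw [Units.val_mul, rhoUnit_val, rhoUnit_val, rhoUnit_val, rho, rho, rho,
    Tplus_mul_apply_zero hk, Real.sqrt_mul hh.1.le, Matrix.smul_mul, Matrix.mul_smul, smul_smul,
    _root_.mul_inv_rev, Units.val_mul, Matrix.transpose_mul]

/-- The (1,1) entry of ρ(h)⁻¹ = hᵀ/√h₁₁ is √h₁₁, so ρ(h) determines its own scaling factor and hence
h. -/
theorem rhoUnit_injective {h k : GL (Fin d) ℝ} (hh : h ∈ Tplus d) (hk : k ∈ Tplus d)
    (e : rhoUnit hh = rhoUnit hk) : h = k := by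
  have h1 : (Real.sqrt (h.val 0 0))⁻¹ • h.valᵀ = (Real.sqrt (k.val 0 0))⁻¹ • k.valᵀ := by
    rw [← rhoUnit_inv_val hh, ← rhoUnit_inv_val hk, e]
  have h2 := congrFun (congrFun h1 0) 0
  simp only [Matrix.smul_apply, Matrix.transpose_apply, smul_eq_mul] at h2
  have h3 : ∀ x : ℝ, (Real.sqrt x)⁻¹ * x = Real.sqrt x := fun x => by
    rw [mul_comm, ← div_eq_mul_inv, Real.div_sqrt]
  rw [h3, h3] at h2
  rw [h2] at h1
  have h4 : Real.sqrt (k.val 0 0) ≠ 0 := (Real.sqrt_pos.2 hk.1).ne'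
  exact Units.ext (Matrix.transpose_injective (smul_right_injective _ (inv_ne_zero h4) h1))

/-- The reason for the factor √h₁₁ in ρ: the left side is h₁₁⁻¹ h σ_b hᵀ, and the scalar cancels the
h₁₁ of `mul_sigma_mul_transpose`. -/
theorem contragredient_rhoUnit_conj_sigma {h : GL (Fin d) ℝ} (hh : h ∈ Tplus d) (b : E d) :
    (contragredient (rhoUnit hh)).val * sigma b * (rhoUnit hh)⁻¹.val = sigma (act h.val b) := by
  have h0 := hh.1
  rw [contragredient_val, rhoUnit_inv_val, Matrix.transpose_smul, Matrix.transpose_transpose,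
    Matrix.mul_smul, Matrix.smul_mul, Matrix.smul_mul, smul_smul, mul_sigma_mul_transpose hh,
    smul_smul, ← _root_.mul_inv_rev, Real.mul_self_sqrt h0.le, inv_mul_cancel₀ h0.ne', one_smul]

variable {H : Subgroup (GL (Fin d) ℝ)}

theorem AffGroup.h_mem (hH : H ≤ Tplus d) (x : AffGroup H) : x.h ∈ Tplus d := hH x.right.property

/-- The embedding `φ(b,h) = g(σ_b, ρ(h))` of `ℝ^d ⋊ H` into the symplectic group. -/
def symplecticEmbedding (hH : H ≤ Tplus d) : AffGroup H →* Matrix.symplecticGroup (Fin d) ℝ :=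
  MonoidHom.mk' (fun x => ⟨gMat (sigma x.b) (rho x.h),
    gMat_mem_symplecticGroup (sigma_transpose x.b) (rhoUnit (x.h_mem hH))⟩) fun x y => by
      ext1
      change gMat (sigma (x * y).b) (rhoUnit ((x * y).h_mem hH)).val =
        gMat (sigma x.b) (rhoUnit (x.h_mem hH)).val * gMat (sigma y.b) (rhoUnit (y.h_mem hH)).val
      rw [gMat_mul, contragredient_rhoUnit_conj_sigma, rhoUnit_mul, ← sigma_add]
      rfl

theorem symplecticEmbedding_val (hH : H ≤ Tplus d) (x : AffGroup H) :
    (symplecticEmbedding hH x).val = gMat (sigma x.b) (rho x.h) := rfl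

theorem symplecticEmbedding_injective (hH : H ≤ Tplus d) :
    Function.Injective (symplecticEmbedding hH) := by
  intro x y e
  obtain ⟨h1, h2⟩ := gMat_injective (M := rhoUnit (x.h_mem hH)) (N := rhoUnit (y.h_mem hH))
    (congrArg Subtype.val e)
  have h3 : x.b = y.b := sigma_injective h1
  have h4 : x.h = y.h := rhoUnit_injective _ _ h2
  exact SemidirectProduct.ext h3 (Subtype.ext h4)

end Algebra

/-! ### Operators with a phase and a dilation, Weyl covariance, and the lift of φ -/

section Metaplectic

variable {d : ℕ}

/-- Multiplication by the phase `e^{iθ}`. -/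
def phaseFun (θ : E d → ℝ) (f : E d → ℂ) : E d → ℂ := fun ξ =>
  Complex.exp ((θ ξ : ℂ) * Complex.I) * f ξ

theorem memLp_phaseFun (θ : C(E d, ℝ)) {f : E d → ℂ} (hf : MemLp f 2 volume) :
    MemLp (phaseFun θ f) 2 volume := by
  refine hf.of_le (AEStronglyMeasurable.mul (Continuous.aestronglyMeasurable ?_) hf.1)
    (Eventually.of_forall fun ξ => ?_)
  · fun_prop
  · rw [phaseFun, norm_mul, Complex.norm_exp_ofReal_mul_I, one_mul]

theorem phaseFun_congr (θ : E d → ℝ) {f g : E d → ℂ} (hfg : f =ᵐ[volume] g) :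
    phaseFun θ f =ᵐ[volume] phaseFun θ g := by
  filter_upwards [hfg] with ξ h
  rw [phaseFun, phaseFun, h]

theorem phaseFun_phaseFun (θ η : E d → ℝ) (f : E d → ℂ) :
    phaseFun θ (phaseFun η f) = phaseFun (θ + η) f := by
  ext ξ
  simp only [phaseFun, Pi.add_apply, Complex.ofReal_add, add_mul, Complex.exp_add, mul_assoc]

theorem phaseFun_zero (f : E d → ℂ) : phaseFun 0 f = f := by
  ext ξ
  simp [phaseFun]

theorem toLp_phaseFun_toLp (θ η : C(E d, ℝ)) (h : θ + η = 0) (f : L2 d) :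
    (memLp_phaseFun θ (Lp.memLp ((memLp_phaseFun η (Lp.memLp f)).toLp _))).toLp _ = f := by
  apply Lp.ext
  refine (MemLp.coeFn_toLp _).trans ((phaseFun_congr θ (MemLp.coeFn_toLp _)).trans ?_)
  rw [phaseFun_phaseFun, ← ContinuousMap.coe_add, h, ContinuousMap.coe_zero, phaseFun_zero]

/-- The unitary operator of multiplication by `e^{iθ}`. -/
def phaseOp (θ : C(E d, ℝ)) : L2 d ≃ₗᵢ[ℂ] L2 d where
  toFun f := (memLp_phaseFun θ (Lp.memLp f)).toLp _
  invFun f := (memLp_phaseFun (-θ) (Lp.memLp f)).toLp _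
  map_add' f g := by
    rw [← MemLp.toLp_add, MemLp.toLp_eq_toLp_iff]
    refine (phaseFun_congr θ (Lp.coeFn_add f g)).trans (Eventually.of_forall fun y => ?_)
    simp only [phaseFun, Pi.add_apply, mul_add]
  map_smul' c f := by
    rw [RingHom.id_apply, ← MemLp.toLp_const_smul, MemLp.toLp_eq_toLp_iff]
    refine (phaseFun_congr θ (Lp.coeFn_smul c f)).trans (Eventually.of_forall fun y => ?_)
    simp only [phaseFun, Pi.smul_apply, smul_eq_mul]
    ring
  left_inv f := toLp_phaseFun_toLp _ _ (neg_add_cancel θ) f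
  right_inv f := toLp_phaseFun_toLp _ _ (add_neg_cancel θ) f
  norm_map' f := by
    change ‖(memLp_phaseFun θ (Lp.memLp f)).toLp _‖ = ‖f‖
    rw [Lp.norm_toLp, Lp.norm_def]
    congr 1
    refine eLpNorm_congr_norm_ae (Eventually.of_forall fun ξ => ?_)
    rw [phaseFun, norm_mul, Complex.norm_exp_ofReal_mul_I, one_mul]

theorem coeFn_phaseOp (θ : C(E d, ℝ)) (f : L2 d) : phaseOp θ f =ᵐ[volume] phaseFun θ f :=
  MemLp.coeFn_toLp (memLp_phaseFun θ (Lp.memLp f))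

/-- The function `ξ ↦ e^{iθ(ξ)} |det M|^{-1/2} f(M⁻¹ ξ)`. -/
def metaFun (θ : E d → ℝ) (M : GL (Fin d) ℝ) (f : E d → ℂ) : E d → ℂ := phaseFun θ (affFun 0 M f)

theorem metaFun_apply (θ : E d → ℝ) (M : GL (Fin d) ℝ) (f : E d → ℂ) (ξ : E d) :
    metaFun θ M f ξ = Complex.exp ((θ ξ : ℂ) * Complex.I) *
      (((|M.val.det| ^ (-(1 / 2) : ℝ) : ℝ) : ℂ) * f (act (M⁻¹).val ξ)) := by
  rw [metaFun, phaseFun, affFun, sub_zero]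

theorem metaFun_congr (θ : E d → ℝ) (M : GL (Fin d) ℝ) {f g : E d → ℂ} (hfg : f =ᵐ[volume] g) :
    metaFun θ M f =ᵐ[volume] metaFun θ M g :=
  phaseFun_congr θ (affFun_congr 0 M hfg)

theorem metaFun_metaFun (θ η : E d → ℝ) (M N : GL (Fin d) ℝ) (f : E d → ℂ) :
    metaFun θ M (metaFun η N f) =
      metaFun (fun ξ => θ ξ + η (act (M⁻¹).val ξ)) (M * N) f := by
  ext ξ
  simp only [metaFun_apply, _root_.mul_inv_rev, Units.val_mul, act_mul, Matrix.det_mul, abs_mul,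
    Real.mul_rpow (abs_nonneg _) (abs_nonneg _), Complex.ofReal_add, Complex.ofReal_mul, add_mul,
    Complex.exp_add]
  ring

/-- The unitary operator `f ↦ e^{iθ} |det M|^{-1/2} f(M⁻¹ ·)`. -/
def metaOp (θ : C(E d, ℝ)) (M : GL (Fin d) ℝ) : L2 d ≃ₗᵢ[ℂ] L2 d :=
  -- The dilation is the quasi-regular operator of (0,M) for the full linear group, so its inverse
  -- comes from the group law.
  (quasiRegular ⊤ ⟨1, ⟨M, Subgroup.mem_top M⟩⟩).trans (phaseOp θ)

theorem coeFn_metaOp (θ : C(E d, ℝ)) (M : GL (Fin d) ℝ) (f : L2 d) :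
    metaOp θ M f =ᵐ[volume] metaFun θ M f :=
  (coeFn_phaseOp θ _).trans (phaseFun_congr θ (coeFn_affOp 0 M f))

/-- The composite phase is passed as `κ` with a pointwise equation, so that it may be any bundled
continuous function with the right values. -/
theorem metaOp_metaOp (θ η κ : C(E d, ℝ)) (M N : GL (Fin d) ℝ)
    (hκ : ∀ ξ, κ ξ = θ ξ + η (act (M⁻¹).val ξ)) (f : L2 d) :
    metaOp θ M (metaOp η N f) = metaOp κ (M * N) f := by
  apply Lp.ext
  refine (coeFn_metaOp _ _ _).trans ((metaFun_congr _ _ (coeFn_metaOp _ _ _)).trans ?_)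
  rw [metaFun_metaFun, ← funext hκ]
  exact (coeFn_metaOp _ _ _).symm

theorem coeFn_weyl (z : Fin d ⊕ Fin d → ℝ) (f : L2 d) : weyl z f =ᵐ[volume] weylFun z f :=
  MemLp.coeFn_toLp (memLp_weylFun z (Lp.memLp f))

theorem weylFun_congr (z : Fin d ⊕ Fin d → ℝ) {f g : E d → ℂ} (hfg : f =ᵐ[volume] g) :
    weylFun z f =ᵐ[volume] weylFun z g := by
  filter_upwards [(measurePreserving_sub_right (volume : Measure (E d))
    (pos z)).quasiMeasurePreserving.ae_eq_comp hfg] with t ht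
  simp only [Function.comp_apply] at ht
  rw [weylFun, weylFun, ht]

/-- The phase `π ⟨σ ξ, ξ⟩`. -/
def quadPhase (σ : Matrix (Fin d) (Fin d) ℝ) : C(E d, ℝ) where
  toFun ξ := Real.pi * inner ℝ (act σ ξ) ξ
  continuous_toFun := by fun_prop

theorem quadPhase_apply (σ : Matrix (Fin d) (Fin d) ℝ) (ξ : E d) :
    quadPhase σ ξ = Real.pi * inner ℝ (act σ ξ) ξ := rfl

theorem pos_gMat_mulVec (σ : Matrix (Fin d) (Fin d) ℝ) (M : GL (Fin d) ℝ)
    (z : Fin d ⊕ Fin d → ℝ) : pos (gMat σ M.val *ᵥ z) = act M.val (pos z) := by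
  ext i
  simp [pos, gMat, Matrix.mulVec, dotProduct]

theorem freq_gMat_mulVec (σ : Matrix (Fin d) (Fin d) ℝ) (M : GL (Fin d) ℝ)
    (z : Fin d ⊕ Fin d → ℝ) :
    freq (gMat σ M.val *ᵥ z) =
      act σ (act M.val (pos z)) + act (contragredient M).val (freq z) := by
  rw [← act_mul]
  ext i
  simp [pos, freq, gMat, Matrix.mulVec, dotProduct, contragredient_val]

/-- On the right, expand ⟨σ(ξ-Mp), ξ-Mp⟩. Its cross term cancels the modulation by the extra
frequency σMp, and its term ⟨σMp,Mp⟩ cancels the extra part of the normalising phase -πi⟨p,ω⟩. The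
remaining phases agree because M⁻ᵀ is dual to M⁻¹. -/
theorem metaFun_weylFun {σ : Matrix (Fin d) (Fin d) ℝ} (hσ : σᵀ = σ) (M : GL (Fin d) ℝ)
    (z : Fin d ⊕ Fin d → ℝ) (f : E d → ℂ) :
    metaFun (quadPhase σ) M (weylFun z f) =
      weylFun (gMat σ M.val *ᵥ z) (metaFun (quadPhase σ) M f) := by
  ext ξ
  have hsym : ∀ x y : E d, inner ℝ (act σ x) y = inner ℝ (act σ y) x := fun x y => by
    rw [inner_act_left, hσ, real_inner_comm]
  simp only [metaFun_apply, weylFun, pos_gMat_mulVec, freq_gMat_mulVec, quadPhase_apply]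
  generalize pos z = p
  generalize freq z = w
  have h1 : inner ℝ w (act (M⁻¹).val ξ) = inner ℝ (act (contragredient M).val w) ξ := by
    rw [inner_act_left, contragredient_val, Matrix.transpose_transpose]
  have h2 : inner ℝ (act M.val p) (act (contragredient M).val w) = inner ℝ p w := by
    rw [inner_act_left, contragredient_val, ← act_mul, ← Matrix.transpose_mul, ← Units.val_mul,
      inv_mul_cancel, Units.val_one, Matrix.transpose_one, act_one]
  rw [h1, map_sub (act (M⁻¹).val), act_inv_act]
  simp only [inner_add_left, inner_add_right, inner_sub_left, inner_sub_right, map_sub, h2,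
    hsym ξ (act M.val p)]
  rw [real_inner_comm (act M.val p) (act σ (act M.val p))]
  -- The moduli and the values of `f` agree on both sides; only the sum of the real phases has to be
  -- compared.
  have key : ∀ (a b a' b' : ℝ) (u v : ℂ), a + b = a' + b' →
      Complex.exp (a * Complex.I) * (u * (Complex.exp (b * Complex.I) * v)) =
      Complex.exp (a' * Complex.I) * (Complex.exp (b' * Complex.I) * (u * v)) := by
    intro a b a' b' u v h
    have h3 : Complex.exp (a * Complex.I) * Complex.exp (b * Complex.I) =
        Complex.exp (a' * Complex.I) * Complex.exp (b' * Complex.I) := by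
      rw [← Complex.exp_add, ← Complex.exp_add, ← add_mul, ← add_mul, ← Complex.ofReal_add,
        ← Complex.ofReal_add, h]
    linear_combination u * v * h3
  apply key
  ring

theorem metaOp_weyl {σ : Matrix (Fin d) (Fin d) ℝ} (hσ : σᵀ = σ) (M : GL (Fin d) ℝ)
    (z : Fin d ⊕ Fin d → ℝ) (f : L2 d) :
    metaOp (quadPhase σ) M (weyl z f) =
      weyl (gMat σ M.val *ᵥ z) (metaOp (quadPhase σ) M f) := by
  apply Lp.ext
  refine (coeFn_metaOp _ _ _).trans ((metaFun_congr _ _ (coeFn_weyl _ _)).trans ?_)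
  rw [metaFun_weylFun hσ]
  exact ((coeFn_weyl _ _).trans (weylFun_congr _ (coeFn_metaOp _ _ _))).symm

variable [NeZero d] {H : Subgroup (GL (Fin d) ℝ)}

/-- The cocycle identity by which the lift is a true homomorphism, not merely one up to scalars. -/
theorem quadPhase_sigma_add_act (b c : E d) {h : GL (Fin d) ℝ} (hh : h ∈ Tplus d) (ξ : E d) :
    quadPhase (sigma (b + act h.val c)) ξ =
      quadPhase (sigma b) ξ + quadPhase (sigma c) (act ((rhoUnit hh)⁻¹).val ξ) := by
  rw [sigma_add, ← contragredient_rhoUnit_conj_sigma hh c]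
  simp only [quadPhase_apply]
  rw [act, map_add, _root_.add_apply, inner_add_left, mul_add, act_mul, act_mul,
    inner_act_left (contragredient _).val, contragredient_val, Matrix.transpose_transpose]

/-- The lift of `φ` to the metaplectic group. -/
def metaplecticLift (hH : H ≤ Tplus d) : AffGroup H →* metaplecticGroup d :=
  MonoidHom.mk' (fun x =>
    ⟨(symplecticEmbedding hH x, metaOp (quadPhase (sigma x.b)) (rhoUnit (x.h_mem hH))),
      fun z f => metaOp_weyl (sigma_transpose x.b) (rhoUnit (x.h_mem hH)) z f⟩) fun x y => by
    refine Subtype.ext (Prod.ext (map_mul (symplecticEmbedding hH) x y) ?_)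
    ext1 f
    change metaOp (quadPhase (sigma (x.b + act x.h.val y.b))) (rhoUnit ((x * y).h_mem hH)) f =
      metaOp (quadPhase (sigma x.b)) (rhoUnit (x.h_mem hH))
        (metaOp (quadPhase (sigma y.b)) (rhoUnit (y.h_mem hH)) f)
    rw [metaOp_metaOp _ _ _ _ _ (quadPhase_sigma_add_act x.b y.b (x.h_mem hH)), rhoUnit_mul]
    rfl

theorem metaplecticRep_metaplecticLift (hH : H ≤ Tplus d) (x : AffGroup H) :
    metaplecticRep d (metaplecticLift hH x) =
      metaOp (quadPhase (sigma x.b)) (rhoUnit (x.h_mem hH)) := rfl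

theorem coeFn_metaplecticLift (hH : H ≤ Tplus d) (x : AffGroup H) (f : L2 d) :
    ∀ᵐ ξ : E d, metaplecticRep d (metaplecticLift hH x) f ξ =
      ((|(rho x.h).det| ^ (-(1 / 2) : ℝ) : ℝ) : ℂ) *
        Complex.exp (((Real.pi * inner ℝ (act (sigma x.b) ξ) ξ : ℝ) : ℂ) * Complex.I) *
        f (act (rho x.h)⁻¹ ξ) := by
  rw [metaplecticRep_metaplecticLift]
  filter_upwards [coeFn_metaOp (quadPhase (sigma x.b)) (rhoUnit (x.h_mem hH)) f] with ξ h
  rw [h, metaFun_apply, Matrix.coe_units_inv, rhoUnit_val, quadPhase_apply]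
  ring

end Metaplectic

/-! ### The quasi-regular representation on the Fourier side -/

section Fourier

/-- `affFun b h f` as a Schwartz function. -/
def affSchwartz {d : ℕ} (b : E d) (h : GL (Fin d) ℝ) (f : SchwartzMap (E d) ℂ) :
    SchwartzMap (E d) ℂ :=
  ((|h.val.det| ^ (-(1 / 2) : ℝ) : ℝ) : ℂ) •
    SchwartzMap.compSubConstCLM ℂ b (SchwartzMap.compCLMOfContinuousLinearEquiv ℂ
      (ContinuousLinearEquiv.equivOfInverse (act (h⁻¹).val) (act h.val) (act_act_inv h)
        (act_inv_act h)) f)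

variable {d : ℕ}

theorem coe_affSchwartz (b : E d) (h : GL (Fin d) ℝ) (f : SchwartzMap (E d) ℂ) :
    ⇑(affSchwartz b h f) = affFun b h f := rfl

theorem affOp_toLp (b : E d) (h : GL (Fin d) ℝ) (f : SchwartzMap (E d) ℂ) :
    affOp b h (f.toLp 2) = (affSchwartz b h f).toLp 2 := by
  apply Lp.ext
  refine (coeFn_affOp _ _ _).trans ((affFun_congr _ _ (f.coeFn_toLp 2)).trans ?_)
  rw [← coe_affSchwartz]
  exact ((affSchwartz b h f).coeFn_toLp 2).symm

theorem integral_comp_affine (b : E d) (h : GL (Fin d) ℝ) (g : E d → ℂ) :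
    ∫ y, g (act (h⁻¹).val (y - b)) = |h.val.det| • ∫ x, g x := by
  have hinj : Function.Injective (fun y => act (h⁻¹).val (y - b)) := by
    intro x y hxy
    have h1 : act h.val (act (h⁻¹).val (x - b)) = act h.val (act (h⁻¹).val (y - b)) :=
      congrArg (act h.val) hxy
    rwa [act_act_inv, act_act_inv, sub_left_inj] at h1
  have hemb : MeasurableEmbedding (fun y => act (h⁻¹).val (y - b)) :=
    Continuous.measurableEmbedding (by fun_prop) hinj
  rw [← hemb.integral_map, map_affine, integral_smul_measure,
    ENNReal.toReal_ofReal (abs_nonneg _)]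

/-- The phase `-2π ⟨b, ξ⟩`. -/
def translationPhase (b : E d) : C(E d, ℝ) where
  toFun ξ := -2 * Real.pi * inner ℝ b ξ
  continuous_toFun := by fun_prop

theorem translationPhase_apply (b ξ : E d) :
    translationPhase b ξ = -2 * Real.pi * inner ℝ b ξ := rfl

/-- The substitution in the Fourier integral contributes |det h|; with the factor |det h|^{-1/2} of
π this is exactly the normalisation belonging to h⁻ᵀ. -/
theorem det_contragredient_factor (h : GL (Fin d) ℝ) :
    |(contragredient h).val.det| ^ (-(1 / 2) : ℝ) = |h.val.det| * |h.val.det| ^ (-(1 / 2) : ℝ) := by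
  have h0 : 0 < |h.val.det| := abs_pos.2 (det_val_ne_zero h)
  rw [contragredient_val, Matrix.det_transpose, det_inv_val, abs_inv, Real.inv_rpow h0.le,
    ← Real.rpow_neg h0.le, ← Real.rpow_one_add' h0.le (by norm_num)]
  norm_num

/-- Substitute x = h⁻¹(y - b), so that ⟨y,ξ⟩ = ⟨b,ξ⟩ + ⟨x,hᵀξ⟩. No integrability is needed, since
the substitution is a measurable embedding. -/
theorem fourier_affFun (b : E d) (h : GL (Fin d) ℝ) (f : E d → ℂ) :
    𝓕 (affFun b h f) = metaFun (translationPhase b) (contragredient h) (𝓕 f) := by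
  ext ξ
  -- `g` is the integrand in the variable x, kept opaque until the substitution has been made.
  obtain ⟨g, hg⟩ : ∃ g : E d → ℂ, g = fun x =>
      Complex.exp ((translationPhase b ξ : ℂ) * Complex.I) *
        (((|h.val.det| ^ (-(1 / 2) : ℝ) : ℝ) : ℂ) *
          (Complex.exp (((-2 * Real.pi * inner ℝ x (act (h.val)ᵀ ξ) : ℝ) : ℂ) * Complex.I) •
            f x)) := ⟨_, rfl⟩
  have h1 : ∀ y : E d, (Complex.exp (((-2 * Real.pi * inner ℝ y ξ : ℝ) : ℂ) * Complex.I) •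
      affFun b h f y : ℂ) = g (act (h⁻¹).val (y - b)) := by
    intro y
    have h2 : inner ℝ y ξ = inner ℝ b ξ + inner ℝ (act (h⁻¹).val (y - b)) (act h.valᵀ ξ) := by
      rw [← inner_act_left, act_act_inv, ← inner_add_left, add_sub_cancel]
    simp only [hg, affFun, h2, mul_add, Complex.ofReal_add, add_mul, Complex.exp_add, smul_eq_mul,
      translationPhase_apply]
    ring
  rw [Real.fourier_eq', integral_congr_ae (Eventually.of_forall h1), integral_comp_affine, hg,
    integral_const_mul, integral_const_mul, metaFun_apply, Real.fourier_eq',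
    contragredient_inv_val, det_contragredient_factor, Complex.real_smul]
  push_cast
  ring

theorem coeFn_fourierL2_toLp (g : SchwartzMap (E d) ℂ) :
    fourierL2 d (g.toLp 2) =ᵐ[volume] 𝓕 (g : E d → ℂ) := by
  have h1 : fourierL2 d (g.toLp 2) = (𝓕 g : SchwartzMap (E d) ℂ).toLp 2 :=
    SchwartzMap.toLp_fourier_eq g
  rw [h1, ← SchwartzMap.fourier_coe]
  exact SchwartzMap.coeFn_toLp (𝓕 g : SchwartzMap (E d) ℂ) 2 volume

/-- Both sides are continuous in f and agree on the dense Schwartz functions, where the integral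
formula applies. -/
theorem fourierL2_affOp (b : E d) (h : GL (Fin d) ℝ) (f : L2 d) :
    fourierL2 d (affOp b h f) = metaOp (translationPhase b) (contragredient h) (fourierL2 d f) := by
  refine DenseRange.induction_on
    (p := fun f : L2 d => fourierL2 d (affOp b h f) =
      metaOp (translationPhase b) (contragredient h) (fourierL2 d f))
    (SchwartzMap.denseRange_toLpCLM (E := E d) (F := ℂ) (p := 2) ENNReal.ofNat_ne_top)
    f ?_ ?_
  · exact isClosed_eq ((fourierL2 d).continuous.comp (affOp b h).continuous)
      ((metaOp _ _).continuous.comp (fourierL2 d).continuous)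
  · intro g
    change fourierL2 d (affOp b h (g.toLp 2)) = metaOp _ _ (fourierL2 d (g.toLp 2))
    rw [affOp_toLp]
    apply Lp.ext
    refine (coeFn_fourierL2_toLp _).trans (EventuallyEq.symm ((coeFn_metaOp _ _ _).trans
      ((metaFun_congr _ _ (coeFn_fourierL2_toLp g)).trans ?_)))
    rw [coe_affSchwartz, fourier_affFun]

end Fourier

/-! ### Weighted composition operators on L²(Θ_L) -/

section ChangeOfVariables

variable {d : ℕ}

theorem det_comp (A B : E d →L[ℝ] E d) : (A.comp B).det = A.det * B.det :=
  LinearMap.det_comp (A : E d →ₗ[ℝ] E d) (B : E d →ₗ[ℝ] E d)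

/-- `φ` restricts to a differentiable bijection of the open set `s` with differentiable
inverse `ψ`. -/
structure IsDiffeoOn (s : Set (E d)) (φ ψ : E d → E d) : Prop where
  isOpen : IsOpen s
  measurable : Measurable φ
  measurable_inv : Measurable ψ
  differentiableAt : ∀ ξ ∈ s, DifferentiableAt ℝ φ ξ
  differentiableAt_inv : ∀ ξ ∈ s, DifferentiableAt ℝ ψ ξ
  mapsTo : MapsTo φ s s
  mapsTo_inv : MapsTo ψ s s
  invOn : InvOn ψ φ s s

variable {s : Set (E d)} {φ ψ : E d → E d}

theorem IsDiffeoOn.symm (hp : IsDiffeoOn s φ ψ) : IsDiffeoOn s ψ φ :=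
  ⟨hp.isOpen, hp.measurable_inv, hp.measurable, hp.differentiableAt_inv, hp.differentiableAt,
    hp.mapsTo_inv, hp.mapsTo, hp.invOn.symm⟩

theorem IsDiffeoOn.bijOn (hp : IsDiffeoOn s φ ψ) : BijOn φ s s :=
  hp.invOn.bijOn hp.mapsTo hp.mapsTo_inv

/-- The part in s of a preimage under φ lies in an image under ψ, and differentiable maps send null
sets to null sets. -/
theorem IsDiffeoOn.quasiMeasurePreserving (hp : IsDiffeoOn s φ ψ) :
    Measure.QuasiMeasurePreserving φ ((volume : Measure (E d)).restrict s)
      ((volume : Measure (E d)).restrict s) := by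
  refine ⟨hp.measurable, Measure.AbsolutelyContinuous.mk fun t ht h0 => ?_⟩
  rw [Measure.restrict_apply ht] at h0
  rw [Measure.map_apply hp.measurable ht, Measure.restrict_apply (hp.measurable ht)]
  refine measure_mono_null (t := ψ '' (t ∩ s)) ?_
    (addHaar_image_eq_zero_of_differentiableOn_of_addHaar_eq_zero _
      (fun x hx => (hp.differentiableAt_inv x hx.2).differentiableWithinAt) h0)
  rintro x ⟨hx1, hx2⟩
  exact ⟨φ x, ⟨hx1, hp.mapsTo hx2⟩, hp.invOn.1 hx2⟩

/-- Chain rule for ψ ∘ φ, which is the identity near ξ because s is open. -/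
theorem IsDiffeoOn.det_mul_det (hp : IsDiffeoOn s φ ψ) {ξ : E d} (hξ : ξ ∈ s) :
    (fderiv ℝ φ ξ).det * (fderiv ℝ ψ (φ ξ)).det = 1 := by
  have h1 : fderiv ℝ (ψ ∘ φ) ξ = ContinuousLinearMap.id ℝ (E d) := by
    rw [← fderiv_id (x := ξ)]
    refine Filter.EventuallyEq.fderiv_eq ?_
    filter_upwards [hp.isOpen.mem_nhds hξ] with x hx
    exact hp.invOn.1 hx
  rw [fderiv_comp ξ (hp.differentiableAt_inv _ (hp.mapsTo hξ)) (hp.differentiableAt ξ hξ)] at h1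
  rw [mul_comm, ← det_comp, h1]
  exact LinearMap.det_id

/-- The function `ξ ↦ |det Dφ(ξ)|^{1/2} f(φ(ξ))` on `s`, extended by zero. -/
def pullFun (s : Set (E d)) (φ : E d → E d) (f : E d → ℂ) : E d → ℂ := s.indicator fun ξ =>
  ((|(fderiv ℝ φ ξ).det| ^ (1 / 2 : ℝ) : ℝ) : ℂ) * f (φ ξ)

theorem IsDiffeoOn.pullFun_congr (hp : IsDiffeoOn s φ ψ) {f g : E d → ℂ} (hfg : f =ᵐ[volume] g) :
    pullFun s φ f =ᵐ[volume] pullFun s φ g := by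
  have h1 := hp.quasiMeasurePreserving.ae_eq_comp (ae_restrict_of_ae hfg)
  filter_upwards [(ae_restrict_iff' hp.isOpen.measurableSet).1 h1] with ξ h
  by_cases hξ : ξ ∈ s
  · have := h hξ
    simp only [Function.comp_apply] at this
    simp only [pullFun, indicator_of_mem hξ, this]
  · simp only [pullFun, indicator_of_notMem hξ]

theorem IsDiffeoOn.pullFun_pullFun (hp : IsDiffeoOn s φ ψ) (f : E d → ℂ) :
    pullFun s φ (pullFun s ψ f) = s.indicator f := by
  ext ξ
  by_cases hξ : ξ ∈ s
  · simp only [pullFun, indicator_of_mem hξ, indicator_of_mem (hp.mapsTo hξ)]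
    rw [hp.invOn.1 hξ, ← mul_assoc, ← Complex.ofReal_mul,
      ← Real.mul_rpow (abs_nonneg _) (abs_nonneg _), ← abs_mul, hp.det_mul_det hξ]
    simp
  · simp only [pullFun, indicator_of_notMem hξ]

theorem IsDiffeoOn.aestronglyMeasurable_pullFun (hp : IsDiffeoOn s φ ψ) {f : E d → ℂ}
    (hf : AEStronglyMeasurable f volume) : AEStronglyMeasurable (pullFun s φ f) volume := by
  refine (aestronglyMeasurable_indicator_iff hp.isOpen.measurableSet).2 (AEStronglyMeasurable.mul ?_
    ((hf.mono_measure Measure.restrict_le_self).comp_quasiMeasurePreserving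
      hp.quasiMeasurePreserving))
  have h1 : Measurable fun ξ => (fderiv ℝ φ ξ).det :=
    ContinuousLinearMap.continuous_det.measurable.comp (measurable_fderiv ℝ φ)
  exact (Complex.measurable_ofReal.comp (h1.abs.pow_const _)).aestronglyMeasurable

/-- Squaring turns the weight |det Dφ|^{1/2} into the Jacobian of the change of variables from s =
φ(s). -/
theorem IsDiffeoOn.eLpNorm_pullFun (hp : IsDiffeoOn s φ ψ) (f : E d → ℂ) :
    eLpNorm (pullFun s φ f) 2 volume = eLpNorm f 2 (volume.restrict s) := by
  rw [pullFun, eLpNorm_indicator_eq_eLpNorm_restrict hp.isOpen.measurableSet,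
    eLpNorm_eq_lintegral_rpow_enorm_toReal two_ne_zero ENNReal.ofNat_ne_top,
    eLpNorm_eq_lintegral_rpow_enorm_toReal two_ne_zero ENNReal.ofNat_ne_top]
  congr 1
  conv_rhs => rw [← hp.bijOn.image_eq]
  rw [lintegral_image_eq_lintegral_abs_det_fderiv_mul volume hp.isOpen.measurableSet
    (fun x hx => (hp.differentiableAt x hx).hasFDerivAt.hasFDerivWithinAt) hp.invOn.1.injOn]
  refine lintegral_congr fun ξ => ?_
  rw [enorm_mul, ENNReal.mul_rpow_of_nonneg _ _ (by norm_num)]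
  congr 1
  rw [← ofReal_norm, Complex.norm_real, Real.norm_eq_abs,
    abs_of_nonneg (Real.rpow_nonneg (abs_nonneg _) _),
    ENNReal.ofReal_rpow_of_nonneg (Real.rpow_nonneg (abs_nonneg _) _) (by norm_num),
    ← Real.rpow_mul (abs_nonneg _)]
  norm_num

theorem IsDiffeoOn.memLp_pullFun (hp : IsDiffeoOn s φ ψ) {f : E d → ℂ} (hf : MemLp f 2 volume) :
    MemLp (pullFun s φ f) 2 volume :=
  ⟨hp.aestronglyMeasurable_pullFun hf.1, by
    rw [hp.eLpNorm_pullFun]; exact (hf.restrict s).2⟩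

variable [NeZero d]

theorem interior_ThetaL : interior (ThetaL d) = {ξ | ξ 0 < 0} := by
  have h1 : ThetaL d = (fun ξ : E d => ξ 0) ⁻¹' Iic 0 := rfl
  have h2 : IsOpenMap (fun ξ : E d => ξ 0) :=
    (EuclideanSpace.proj (𝕜 := ℝ) (0 : Fin d)).isOpenMap fun c =>
      ⟨EuclideanSpace.single 0 c, by simp⟩
  rw [h1, ← h2.preimage_interior_eq_interior_preimage (by fun_prop), interior_Iic]
  rfl

/-- The difference lies in the hyperplane ξ₁ = 0, a proper subspace and hence null. This reconciles
the closed set in `L2Theta` with the open set on which Q is a diffeomorphism. -/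
theorem ae_mem_ThetaL_iff : ∀ᵐ ξ : E d, ξ ∈ ThetaL d ↔ ξ ∈ interior (ThetaL d) := by
  have h1 : volume {ξ : E d | ξ 0 = 0} = 0 := by
    have := Measure.addHaar_submodule (volume : Measure (E d))
      (LinearMap.ker (EuclideanSpace.proj (𝕜 := ℝ) (0 : Fin d)).toLinearMap) (by
        intro h
        have h2 : EuclideanSpace.single (0 : Fin d) (1 : ℝ) ∈
          LinearMap.ker (EuclideanSpace.proj (𝕜 := ℝ) (0 : Fin d)).toLinearMap := h ▸ trivial
        simp at h2)
    exact this
  have h2 : ∀ᵐ ξ : E d, ξ 0 ≠ 0 := by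
    rw [ae_iff]
    simpa using h1
  filter_upwards [h2] with ξ h
  rw [interior_ThetaL]
  exact ⟨fun h3 => lt_of_le_of_ne h3 h, fun h3 => (le_of_lt h3 : ξ 0 ≤ 0)⟩

theorem indicator_interior_ThetaL_ae_eq (f : L2Theta d) :
    (interior (ThetaL d)).indicator (f : L2 d) =ᵐ[volume] (f : L2 d) := by
  filter_upwards [f.property, ae_mem_ThetaL_iff (d := d)] with ξ h1 h2
  by_cases h : ξ ∈ interior (ThetaL d)
  · rw [indicator_of_mem h]
  · rw [indicator_of_notMem h, h1 (h2.not.2 h)]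

theorem IsDiffeoOn.toLp_pullFun_mem (hp : IsDiffeoOn (interior (ThetaL d)) φ ψ) (f : L2 d) :
    (hp.memLp_pullFun (Lp.memLp f)).toLp _ ∈ L2Theta d := by
  change ∀ᵐ ξ : E d, _
  filter_upwards [MemLp.coeFn_toLp (hp.memLp_pullFun (Lp.memLp f))] with ξ h1 h2
  rw [h1, pullFun, indicator_of_notMem fun h => h2 (interior_subset h)]

theorem IsDiffeoOn.toLp_pullFun_toLp (hp : IsDiffeoOn (interior (ThetaL d)) φ ψ) (f : L2Theta d) :
    (hp.memLp_pullFun (Lp.memLp ((hp.symm.memLp_pullFun (Lp.memLp (f : L2 d))).toLp _))).toLp _ =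
      (f : L2 d) := by
  apply Lp.ext
  refine (MemLp.coeFn_toLp _).trans ((hp.pullFun_congr (MemLp.coeFn_toLp _)).trans ?_)
  rw [hp.pullFun_pullFun]
  exact indicator_interior_ThetaL_ae_eq f

/-- The unitary operator `f ↦ |det Dφ|^{1/2} f ∘ φ` of `L²(Θ_L)`. -/
def IsDiffeoOn.pullOp (hp : IsDiffeoOn (interior (ThetaL d)) φ ψ) :
    L2Theta d ≃ₗᵢ[ℂ] L2Theta d where
  toFun f := ⟨(hp.memLp_pullFun (Lp.memLp (f : L2 d))).toLp _, hp.toLp_pullFun_mem f⟩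
  invFun f := ⟨(hp.symm.memLp_pullFun (Lp.memLp (f : L2 d))).toLp _, hp.symm.toLp_pullFun_mem f⟩
  map_add' f g := by
    ext1
    change _ = (hp.memLp_pullFun (Lp.memLp (f : L2 d))).toLp _ +
      (hp.memLp_pullFun (Lp.memLp (g : L2 d))).toLp _
    rw [← MemLp.toLp_add, MemLp.toLp_eq_toLp_iff]
    refine (hp.pullFun_congr (Lp.coeFn_add (f : L2 d) g)).trans (Eventually.of_forall fun ξ => ?_)
    by_cases hξ : ξ ∈ interior (ThetaL d)
    · simp only [pullFun, Pi.add_apply, indicator_of_mem hξ, mul_add]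
    · simp only [pullFun, Pi.add_apply, indicator_of_notMem hξ, add_zero]
  map_smul' c f := by
    ext1
    change _ = c • (hp.memLp_pullFun (Lp.memLp (f : L2 d))).toLp _
    rw [← MemLp.toLp_const_smul c (hp.memLp_pullFun (Lp.memLp (f : L2 d))), MemLp.toLp_eq_toLp_iff]
    refine (hp.pullFun_congr (Lp.coeFn_smul c (f : L2 d))).trans (Eventually.of_forall fun ξ => ?_)
    by_cases hξ : ξ ∈ interior (ThetaL d)
    · simp only [pullFun, Pi.smul_apply, indicator_of_mem hξ, smul_eq_mul]
      ring
    · simp only [pullFun, Pi.smul_apply, indicator_of_notMem hξ, smul_zero]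
  left_inv f := by ext1; exact hp.symm.toLp_pullFun_toLp f
  right_inv f := by ext1; exact hp.toLp_pullFun_toLp f
  norm_map' f := by
    change ‖(hp.memLp_pullFun (Lp.memLp (f : L2 d))).toLp _‖ = ‖(f : L2 d)‖
    rw [Lp.norm_toLp, hp.eLpNorm_pullFun, Lp.norm_def,
      ← eLpNorm_indicator_eq_eLpNorm_restrict hp.isOpen.measurableSet,
      eLpNorm_congr_ae (indicator_interior_ThetaL_ae_eq f)]

theorem IsDiffeoOn.coeFn_pullOp (hp : IsDiffeoOn (interior (ThetaL d)) φ ψ) (f : L2Theta d) :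
    (hp.pullOp f : L2 d) =ᵐ[volume] pullFun (interior (ThetaL d)) φ (f : L2 d) :=
  MemLp.coeFn_toLp (hp.memLp_pullFun (Lp.memLp (f : L2 d)))

end ChangeOfVariables

/-! ### The map Q and the equivalence of the two representations -/

section Intertwining

variable {d : ℕ} {H : Subgroup (GL (Fin d) ℝ)}

theorem fourierL2_quasiRegular (x : AffGroup H) (f : L2 d) :
    fourierL2 d (quasiRegular H x f) =
      metaOp (translationPhase x.b) (contragredient x.h) (fourierL2 d f) :=
  fourierL2_affOp x.b x.h f

variable [NeZero d]

theorem mem_interior_ThetaL {ξ : E d} : ξ ∈ interior (ThetaL d) ↔ ξ 0 < 0 := by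
  rw [interior_ThetaL]; rfl

theorem Qmap_apply_zero (ξ : E d) : Qmap ξ 0 = -(1 / 2) * ξ 0 ^ 2 := by
  simp [Qmap]; ring

theorem Qinv_apply_zero (ξ : E d) : Qinv ξ 0 = Real.sqrt 2 / Real.sqrt (-ξ 0) * ξ 0 := rfl

theorem Qmap_mapsTo_ThetaL : MapsTo Qmap (ThetaL d) (ThetaL d) := fun ξ _ => by
  change Qmap ξ 0 ≤ 0
  rw [Qmap_apply_zero]
  nlinarith [sq_nonneg (ξ 0)]

theorem sqrt_two_div_sqrt_sq {x : ℝ} (hx : x < 0) :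
    (Real.sqrt 2 / Real.sqrt (-x)) ^ 2 = 2 / -x := by
  rw [div_pow, Real.sq_sqrt zero_le_two, Real.sq_sqrt (by linarith)]

theorem Qmap_Qinv {ξ : E d} (hξ : ξ 0 < 0) : Qmap (Qinv ξ) = ξ := by
  have h1 : -(1 / 2) * (Real.sqrt 2 / Real.sqrt (-ξ 0) * ξ 0) * (Real.sqrt 2 / Real.sqrt (-ξ 0)) =
      1 := by
    have h2 := sqrt_two_div_sqrt_sq hξ
    have h3 : ξ 0 ≠ 0 := hξ.ne
    calc _ = -(1 / 2) * ξ 0 * (Real.sqrt 2 / Real.sqrt (-ξ 0)) ^ 2 := by ring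
      _ = 1 := by rw [h2]; field_simp
  rw [Qmap, Qinv_apply_zero, Qinv, smul_smul, h1, one_smul]

theorem Qinv_Qmap {ξ : E d} (hξ : ξ 0 < 0) : Qinv (Qmap ξ) = ξ := by
  -- -Q(ξ)₁ = ξ₁²/2, and ξ₁ < 0 decides the sign of the root.
  have h1 : Real.sqrt (-Qmap ξ 0) = -ξ 0 / Real.sqrt 2 := by
    rw [Qmap_apply_zero, Real.sqrt_eq_iff_eq_sq (by nlinarith [sq_nonneg (ξ 0)])
      (div_nonneg (by linarith) (Real.sqrt_nonneg 2)), div_pow, Real.sq_sqrt zero_le_two]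
    ring
  have h2 : Real.sqrt 2 / (-ξ 0 / Real.sqrt 2) * (-(1 / 2) * ξ 0) = 1 := by
    have h3 : ξ 0 ≠ 0 := hξ.ne
    have h4 : Real.sqrt 2 ≠ 0 := by positivity
    field_simp
    rw [Real.sq_sqrt zero_le_two]
  rw [Qinv, h1, Qmap, smul_smul, h2, one_smul]

/-- Q⁻¹ is the forward map here because Ψ composes with it; statements about Q come from
`IsDiffeoOn.symm`. -/
theorem isDiffeoOn_Qinv : IsDiffeoOn (interior (ThetaL d)) Qinv Qmap where
  isOpen := isOpen_interior
  measurable := by unfold Qinv; fun_prop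
  measurable_inv := by unfold Qmap; fun_prop
  differentiableAt ξ hξ := by
    have h0 : ξ 0 < 0 := mem_interior_ThetaL.1 hξ
    have h1 : -ξ 0 ≠ 0 := by linarith
    have h2 : Real.sqrt (-ξ 0) ≠ 0 := (Real.sqrt_pos.2 (by linarith)).ne'
    unfold Qinv
    fun_prop (disch := assumption)
  differentiableAt_inv ξ _ := by unfold Qmap; fun_prop
  mapsTo ξ hξ := by
    rw [mem_interior_ThetaL] at hξ ⊢
    rw [Qinv_apply_zero]
    exact mul_neg_of_pos_of_neg (div_pos (by positivity) (Real.sqrt_pos.2 (by linarith))) hξ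
  mapsTo_inv ξ hξ := by
    rw [mem_interior_ThetaL] at hξ ⊢
    rw [Qmap_apply_zero]
    nlinarith
  invOn := ⟨fun _ hξ => Qmap_Qinv (mem_interior_ThetaL.1 hξ),
    fun _ hξ => Qinv_Qmap (mem_interior_ThetaL.1 hξ)⟩

/-- The first coordinate is multiplied by h₁₁, so the scalar √2/√(-ξ₁) gains the factor 1/√h₁₁ that
turns hᵀ into ρ(h)⁻¹. -/
theorem Qinv_act_transpose {h : GL (Fin d) ℝ} (hh : h ∈ Tplus d) (ξ : E d) :
    Qinv (act h.valᵀ ξ) = act ((rhoUnit hh)⁻¹).val (Qinv ξ) := by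
  rw [rhoUnit_inv_val, act_smul, Qinv, Qinv, act_transpose_apply_zero hh, ← mul_neg,
    Real.sqrt_mul hh.1.le, map_smul, smul_smul]
  congr 1
  rw [div_mul_eq_div_div, div_eq_mul_inv (Real.sqrt 2) (Real.sqrt (h.val 0 0))]
  ring

theorem act_transpose_mem_interior_ThetaL {h : GL (Fin d) ℝ} (hh : h ∈ Tplus d) (ξ : E d) :
    act h.valᵀ ξ ∈ interior (ThetaL d) ↔ ξ ∈ interior (ThetaL d) := by
  rw [mem_interior_ThetaL, mem_interior_ThetaL, act_transpose_apply_zero hh,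
    mul_neg_iff]
  have h0 := hh.1
  exact ⟨fun h1 => h1.elim (fun h2 => h2.2) fun h2 => absurd h2.1 h0.not_gt,
    fun h1 => Or.inl ⟨h0, h1⟩⟩

/-- Chain rule applied to both sides of the equivariance `Qinv_act_transpose`. -/
theorem det_fderiv_Qinv_act_transpose {h : GL (Fin d) ℝ} (hh : h ∈ Tplus d) {ξ : E d}
    (hξ : ξ ∈ interior (ThetaL d)) :
    (fderiv ℝ Qinv (act h.valᵀ ξ)).det * h.val.det =
      (rho h).det⁻¹ * (fderiv ℝ Qinv ξ).det := by
  have h1 := (act_transpose_mem_interior_ThetaL hh ξ).2 hξ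
  have h2 : (Qinv ∘ act h.valᵀ : E d → E d) = act ((rhoUnit hh)⁻¹).val ∘ Qinv :=
    funext (Qinv_act_transpose hh)
  have h3 := congrArg (fun F => (fderiv ℝ F ξ).det) h2
  beta_reduce at h3
  rw [fderiv_comp ξ (isDiffeoOn_Qinv.differentiableAt _ h1) (act h.valᵀ).differentiableAt,
    fderiv_comp ξ (act ((rhoUnit hh)⁻¹).val).differentiableAt
      (isDiffeoOn_Qinv.differentiableAt _ hξ), ContinuousLinearMap.fderiv,
    ContinuousLinearMap.fderiv, det_comp, det_comp] at h3
  have h4 : ∀ M : Matrix (Fin d) (Fin d) ℝ, (act M : E d →L[ℝ] E d).det = M.det := det_act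
  rwa [h4, h4, Matrix.det_transpose, det_inv_val, rhoUnit_val] at h3

theorem quadPhase_sigma_Qinv (b : E d) {ξ : E d} (hξ : ξ 0 < 0) :
    quadPhase (sigma b) (Qinv ξ) = translationPhase b ξ := by
  have h2 := sqrt_two_div_sqrt_sq hξ
  have h3 : ξ 0 ≠ 0 := hξ.ne
  rw [quadPhase_apply, inner_act_sigma, Qinv_apply_zero, Qinv, inner_smul_right,
    translationPhase_apply]
  calc _ = Real.pi * ((Real.sqrt 2 / Real.sqrt (-ξ 0)) ^ 2 * ξ 0 * inner ℝ b ξ) := by ring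
    _ = _ := by rw [h2]; field_simp

/-- The intertwining relation at the level of functions: phases match by `quadPhase_sigma_Qinv`,
arguments by `Qinv_act_transpose`, weights by `det_fderiv_Qinv_act_transpose`. Off the half-space
both sides vanish, since hᵀ preserves it and its complement. -/
theorem pullFun_Qinv_metaFun (b : E d) {h : GL (Fin d) ℝ} (hh : h ∈ Tplus d) (f : E d → ℂ) :
    pullFun (interior (ThetaL d)) Qinv (metaFun (quadPhase (sigma b)) (rhoUnit hh) f) =
      metaFun (translationPhase b) (contragredient h)
        (pullFun (interior (ThetaL d)) Qinv f) := by
  ext ξ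
  rw [metaFun_apply, contragredient_inv_val]
  by_cases hξ : ξ ∈ interior (ThetaL d)
  · rw [pullFun, indicator_of_mem hξ, pullFun,
      indicator_of_mem ((act_transpose_mem_interior_ThetaL hh ξ).2 hξ), metaFun_apply,
      quadPhase_sigma_Qinv b (mem_interior_ThetaL.1 hξ), Qinv_act_transpose hh, rhoUnit_val,
      contragredient_val, Matrix.det_transpose, det_inv_val]
    have hd := det_fderiv_Qinv_act_transpose hh hξ
    have hh0 : 0 < |h.val.det| := abs_pos.2 (det_val_ne_zero h)
    have hr0 : 0 < |(rho h).det| := abs_pos.2 (det_val_ne_zero (rhoUnit hh))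
    -- The square root of the absolute values in `hd`.
    have h1 : |(fderiv ℝ Qinv ξ).det| ^ (1 / 2 : ℝ) * |(rho h).det| ^ (-(1 / 2) : ℝ) =
        |(h.val.det)⁻¹| ^ (-(1 / 2) : ℝ) *
          |(fderiv ℝ Qinv (act h.valᵀ ξ)).det| ^ (1 / 2 : ℝ) := by
      rw [abs_inv, Real.inv_rpow hh0.le, Real.rpow_neg hh0.le, inv_inv, Real.rpow_neg hr0.le,
        ← Real.inv_rpow hr0.le, ← Real.mul_rpow (abs_nonneg _) (inv_nonneg.2 hr0.le),
        ← Real.mul_rpow hh0.le (abs_nonneg _), ← abs_inv, ← abs_mul, ← abs_mul,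
        mul_comm _ (rho h).det⁻¹, ← hd, mul_comm]
    have h2 := congrArg Complex.ofReal h1
    rw [Complex.ofReal_mul, Complex.ofReal_mul] at h2
    linear_combination Complex.exp ((translationPhase b ξ : ℂ) * Complex.I) *
      f (act ((rhoUnit hh)⁻¹).val (Qinv ξ)) * h2
  · rw [pullFun, indicator_of_notMem hξ, pullFun,
      indicator_of_notMem ((act_transpose_mem_interior_ThetaL hh ξ).not.2 hξ), mul_zero, mul_zero]

/-- A positive multiple of ξ₁ keeps its sign, so M⁻¹ maps the complement of Θ_L to itself. The
constant `c` is h₁₁ for π and h₁₁/√h₁₁ for μ ∘ φ. -/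
theorem metaOp_mem_L2Theta (θ : C(E d, ℝ)) {M : GL (Fin d) ℝ} {c : ℝ} (hc : 0 < c)
    (hM : ∀ ξ, act (M⁻¹).val ξ 0 = c * ξ 0) {f : L2 d} (hf : f ∈ L2Theta d) :
    metaOp θ M f ∈ L2Theta d := by
  have h1 : ⇑f =ᵐ[volume] (ThetaL d).indicator f := by
    filter_upwards [hf] with ξ h
    by_cases hξ : ξ ∈ ThetaL d
    · rw [indicator_of_mem hξ]
    · rw [indicator_of_notMem hξ, h hξ]
  change ∀ᵐ ξ : E d, _
  -- Replacing f by its indicator version, which vanishes at every point off Θ_L, allows evaluation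
  -- at M⁻¹ξ.
  filter_upwards [(coeFn_metaOp θ M f).trans (metaFun_congr θ M h1)] with ξ h hξ
  have h2 : act (M⁻¹).val ξ ∉ ThetaL d := fun h3 => hξ (by
    change act (M⁻¹).val ξ 0 ≤ 0 at h3
    rw [hM] at h3
    exact nonpos_of_mul_nonpos_right h3 hc)
  rw [h, metaFun_apply, indicator_of_notMem h2, mul_zero, mul_zero]

theorem quasiRegular_mem_calH (hH : H ≤ Tplus d) (x : AffGroup H) (f : L2 d) (hf : f ∈ calH d) :
    quasiRegular H x f ∈ calH d := by
  change fourierL2 d (quasiRegular H x f) ∈ L2Theta d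
  rw [fourierL2_quasiRegular]
  exact metaOp_mem_L2Theta _ (x.h_mem hH).1 (fun ξ => by
    rw [contragredient_inv_val, act_transpose_apply_zero (x.h_mem hH)]) hf

theorem metaplecticLift_mem_L2Theta (hH : H ≤ Tplus d) (x : AffGroup H) (f : L2 d)
    (hf : f ∈ L2Theta d) : (metaplecticRep d).comp (metaplecticLift hH) x f ∈ L2Theta d := by
  have h0 := (x.h_mem hH).1
  refine metaOp_mem_L2Theta _ (mul_pos (inv_pos.2 (Real.sqrt_pos.2 h0)) h0) (fun ξ => ?_) hf
  rw [rhoUnit_inv_val, act_smul, PiLp.smul_apply, act_transpose_apply_zero (x.h_mem hH),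
    smul_eq_mul, mul_assoc]

theorem pullOp_Qinv_apply (f : L2Theta d) : ∀ᵐ ξ : E d, ξ ∈ ThetaL d →
    (isDiffeoOn_Qinv.pullOp f : L2 d) ξ =
      ((|(fderiv ℝ Qinv ξ).det| ^ (1 / 2 : ℝ) : ℝ) : ℂ) * (f : L2 d) (Qinv ξ) := by
  filter_upwards [isDiffeoOn_Qinv.coeFn_pullOp f, ae_mem_ThetaL_iff (d := d)] with ξ h1 h2 h3
  rw [h1, pullFun, indicator_of_mem (h2.1 h3)]

theorem coe_fourierH (f : calH d) : (fourierH d f : L2 d) = fourierL2 d f := rfl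

theorem coe_restrictRep {G V : Type*} [Group G] [NormedAddCommGroup V] [InnerProductSpace ℂ V]
    (τ : G →* (V ≃ₗᵢ[ℂ] V)) (K : Submodule ℂ V) (hK : ∀ x, ∀ f ∈ K, τ x f ∈ K) (x : G) (f : K) :
    (restrictRep τ K hK x f : V) = τ x f := rfl

theorem pullOp_Qinv_metaOp (b : E d) {h : GL (Fin d) ℝ} (hh : h ∈ Tplus d) (f g : L2Theta d)
    (hg : (g : L2 d) = metaOp (quadPhase (sigma b)) (rhoUnit hh) f) :
    (isDiffeoOn_Qinv.pullOp g : L2 d) =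
      metaOp (translationPhase b) (contragredient h) (isDiffeoOn_Qinv.pullOp f : L2 d) := by
  apply Lp.ext
  refine (isDiffeoOn_Qinv.coeFn_pullOp g).trans (EventuallyEq.symm
    ((coeFn_metaOp _ _ _).trans ((metaFun_congr _ _ (isDiffeoOn_Qinv.coeFn_pullOp f)).trans ?_)))
  rw [← pullFun_Qinv_metaFun b hh, hg]
  exact isDiffeoOn_Qinv.pullFun_congr (coeFn_metaOp _ _ _).symm

/-- The hypothesis ranges over pairs with B w = A v, so that B⁻¹ never has to be evaluated. -/
theorem intertwines_trans_symm {G V W X : Type*} [Group G]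
    [NormedAddCommGroup V] [InnerProductSpace ℂ V] [NormedAddCommGroup W] [InnerProductSpace ℂ W]
    [NormedAddCommGroup X] [InnerProductSpace ℂ X] (A : V ≃ₗᵢ[ℂ] X) (B : W ≃ₗᵢ[ℂ] X)
    (τ₁ : G →* (V ≃ₗᵢ[ℂ] V)) (τ₂ : G →* (W ≃ₗᵢ[ℂ] W))
    (h : ∀ x v w, B w = A v → B (τ₂ x w) = A (τ₁ x v)) :
    Intertwines (A.trans B.symm) τ₁ τ₂ := by
  intro x v
  rw [LinearIsometryEquiv.trans_apply, LinearIsometryEquiv.trans_apply,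
    LinearIsometryEquiv.symm_apply_eq]
  exact (h x v _ (B.apply_symm_apply _)).symm

theorem intertwines_pullOp_Qinv (hH : H ≤ Tplus d) :
    Intertwines ((fourierH d).trans (isDiffeoOn_Qinv (d := d)).pullOp.symm)
      (restrictRep (quasiRegular H) (calH d) (quasiRegular_mem_calH hH))
      (restrictRep ((metaplecticRep d).comp (metaplecticLift hH)) (L2Theta d)
        (metaplecticLift_mem_L2Theta hH)) := by
  refine intertwines_trans_symm _ _ _ _ fun x f g hg => Subtype.ext ?_
  have h1 := pullOp_Qinv_metaOp x.b (x.h_mem hH) g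
    (restrictRep ((metaplecticRep d).comp (metaplecticLift hH)) (L2Theta d)
        (metaplecticLift_mem_L2Theta hH) x g) (coe_restrictRep _ _ _ x g)
  rw [hg, coe_fourierH] at h1
  exact h1.trans (fourierL2_quasiRegular x f).symm

end Intertwining

end ShearletSymplectic

end

theorem mainTheorem2 (d : ℕ) [NeZero d] (H : Subgroup (GL (Fin d) ℝ)) (hH : H ≤ Tplus d) :
    -- the group embedding `φ(b,h) = g(σ_b, ρ(h))` of `G = ℝ^d ⋊ H` into `Sp(d,ℝ)`
    ∃ φ : AffGroup H →* Matrix.symplecticGroup (Fin d) ℝ,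
      Function.Injective φ ∧
      (∀ x : AffGroup H, (φ x).val = gMat (sigma x.b) (rho x.h)) ∧
      -- the metaplectic representation along `φ` : a lift `Φ` of `φ` to the metaplectic group,
      -- normalized by an explicit formula for `μ(φ(b,h))`
      ∃ Φ : AffGroup H →* metaplecticGroup d,
        (metaplecticProj d).comp Φ = φ ∧
        (∀ (x : AffGroup H) (f : L2 d), ∀ᵐ ξ : E d,
          metaplecticRep d (Φ x) f ξ =
            ((|(rho x.h).det| ^ (-(1 / 2) : ℝ) : ℝ) : ℂ) *
              Complex.exp (((Real.pi * inner ℝ (act (sigma x.b) ξ) ξ : ℝ) : ℂ) * Complex.I) *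
              f (act (rho x.h)⁻¹ ξ)) ∧
        -- both representations restrict, and they are unitarily equivalent
        ∃ (hπ : ∀ x, ∀ f ∈ calH d, quasiRegular H x f ∈ calH d)
          (hμ : ∀ x, ∀ f ∈ L2Theta d, (metaplecticRep d).comp Φ x f ∈ L2Theta d)
          (Ψ : L2Theta d ≃ₗᵢ[ℂ] L2Theta d),
          -- `Ψ` is the change of variables by `Q`, a bijection of the interior of `Θ_L`
          Set.MapsTo Qmap (ThetaL d) (ThetaL d) ∧
          Set.BijOn Qmap (interior (ThetaL d)) (interior (ThetaL d)) ∧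
          Set.InvOn Qinv Qmap (interior (ThetaL d)) (interior (ThetaL d)) ∧
          (∀ f : L2Theta d, ∀ᵐ ξ : E d, ξ ∈ ThetaL d →
            (Ψ f : L2 d) ξ =
              ((|(fderiv ℝ Qinv ξ).det| ^ (1 / 2 : ℝ) : ℝ) : ℂ) * (f : L2 d) (Qinv ξ)) ∧
          Intertwines ((fourierH d).trans Ψ.symm)
            (restrictRep (quasiRegular H) (calH d) hπ)
            (restrictRep ((metaplecticRep d).comp Φ) (L2Theta d) hμ) := by
  exact ⟨symplecticEmbedding hH, symplecticEmbedding_injective hH, symplecticEmbedding_val hH,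
    metaplecticLift hH, rfl, coeFn_metaplecticLift hH, quasiRegular_mem_calH hH,
    metaplecticLift_mem_L2Theta hH, isDiffeoOn_Qinv.pullOp, Qmap_mapsTo_ThetaL,
    isDiffeoOn_Qinv.symm.bijOn, isDiffeoOn_Qinv.symm.invOn, pullOp_Qinv_apply,
    intertwines_pullOp_Qinv hH⟩
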